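/- Let $(R,\mathfrak m,\Bbbk)$ be a Noetherian local ring that is $\mathfrak m$-adically complete and Cohen–Macaulay, of dimension $d$. Let $\omega_R$ be its canonical module (a finitely generated $R$-module of depth $d$, of finite injective dimension, with $\dim_{\Bbbk}\operatorname{Ext}^d_R(\Bbbk,\omega_R)=1$), and let $E=E_R(\Bbbk)$ be the injective hull of the residue field. Let $I\subsetneq R$ be a proper ideal and let $c=\operatorname{grade} I$ be the maximal length of an $R$-regular sequence contained in $I$. Write $H^i_I(-)$ and $H^i_{\mathfrak m}(-)$ for the local cohomology modules with respect to $I$ and $\mathfrak m$. Then: (a) There are isomorphisms of $R$-modules $$\operatorname{Hom}_R(H^c_I(\omega_R),H^c_I(\omega_R))\cong \operatorname{Ext}^c_R(H^c_I(\omega_R),\omega_R)\cong \operatorname{Hom}_R(H^{d-c}_{\mathfrak m}(H^c_I(\omega_R)),E).$$ (b) The endomorphism ring $\operatorname{Hom}_R(H^c_I(\omega_R),H^c_I(\omega_R))$ is a finitely generated $R$-module if and only if $\dim_{\Bbbk}\operatorname{Hom}_R(\Bbbk,H^{d-c}_{\mathfrak m}(H^c_I(\omega_R)))$ is finite. (c)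 The natural ring homomorphism $R\to\operatorname{Hom}_R(H^c_I(\omega_R),H^c_I(\omega_R))$, sending $r$ to multiplication by $r$, is surjective if and only if $\dim_{\Bbbk}\operatorname{Hom}_R(\Bbbk,H^{d-c}_{\mathfrak m}(H^c_I(\omega_R)))=1$. -/

import Mathlib

universe u

open CategoryTheory IsLocalRing

namespace LocalCM

/-- The grade of `I` on `M`: the supremum of the lengths of the `M`-regular sequences all of whose
members lie in `I`. -/
noncomputable def idealGrade {R : Type u} [CommRing R] (I : Ideal R)
    (M : Type u) [AddCommGroup M] [Module R M] : ℕ∞ :=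
  ⨆ (rs : List R) (_ : (∀ r ∈ rs, r ∈ I) ∧ RingTheory.Sequence.IsRegular M rs), (rs.length : ℕ∞)

/-- The depth of a module over a local ring: its grade with respect to the maximal ideal. -/
noncomputable def depth (R : Type u) [CommRing R] [IsLocalRing R]
    (M : Type u) [AddCommGroup M] [Module R M] : ℕ∞ :=
  idealGrade (maximalIdeal R) M

/-- A local ring is Cohen-Macaulay if it is Noetherian and its depth equals its Krull dimension. -/
structure IsCohenMacaulay (R : Type u) [CommRing R] [IsLocalRing R] : Prop where
  isNoetherianRing : IsNoetherianRing R
  depth_eq : (depth R R : WithBot ℕ∞) = ringKrullDim R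

/-- A canonical module of a Cohen-Macaulay local ring `R` of dimension `d`:
a maximal Cohen-Macaulay module (finitely generated, of depth `d`) of finite injective dimension
and of type one, i.e. `Ext^d_R(k, ω)` is a one-dimensional vector space over the residue field
`k`. -/
structure IsCanonicalModule (R : Type u) [CommRing R] [IsLocalRing R]
    (ω : Type u) [AddCommGroup ω] [Module R ω] : Prop where
  finite : Module.Finite R ω
  depth_eq : (depth R ω : WithBot ℕ∞) = ringKrullDim R
  finite_injectiveDimension : ∃ n : ℕ, HasInjectiveDimensionLE (ModuleCat.of R ω) n
  type_eq_one : ∀ d : ℕ, ringKrullDim R = d →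
    Nonempty (Abelian.Ext (ModuleCat.of R (ResidueField R)) (ModuleCat.of R ω) d
      ≃ₗ[R] ResidueField R)

/-- `E` is an injective hull of `M`: an injective module into which `M` embeds with essential
image. -/
structure IsInjectiveHull (R : Type u) [CommRing R] (M : Type u) [AddCommGroup M] [Module R M]
    (E : Type u) [AddCommGroup E] [Module R E] : Prop where
  injective : Module.Injective R E
  exists_essential : ∃ f : M →ₗ[R] E, Function.Injective f ∧
    ∀ N : Submodule R E, N ⊓ LinearMap.range f = ⊥ → N = ⊥

/-- The socle `Hom_R(k, N)` of a module `N` over a local ring with residue field `k`. -/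
def Socle (R : Type u) [CommRing R] [IsLocalRing R]
    (N : Type u) [AddCommGroup N] [Module R N] : Type u :=
  ResidueField R →ₗ[R] N

noncomputable instance (R : Type u) [CommRing R] [IsLocalRing R]
    (N : Type u) [AddCommGroup N] [Module R N] : AddCommGroup (Socle R N) :=
  inferInstanceAs (AddCommGroup (ResidueField R →ₗ[R] N))

/-- The vector space structure on `Hom_R(k, N)`, given by `(a • f) x = f (a * x)`. -/
noncomputable instance (R : Type u) [CommRing R] [IsLocalRing R]
    (N : Type u) [AddCommGroup N] [Module R N] : Module (ResidueField R) (Socle R N) where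
  smul a f := LinearMap.comp (show ResidueField R →ₗ[R] N from f) (LinearMap.mulLeft R a)
  one_smul f := LinearMap.ext fun x =>
    congrArg (show ResidueField R →ₗ[R] N from f) (one_mul x)
  mul_smul a b f := LinearMap.ext fun x =>
    congrArg (show ResidueField R →ₗ[R] N from f) (by
      change a * b * x = b * (a * x)
      ring)
  smul_zero a := LinearMap.zero_comp _
  smul_add a f g := LinearMap.add_comp _ _ _
  add_smul a b f := LinearMap.ext fun x =>
    (congrArg (show ResidueField R →ₗ[R] N from f) (add_mul a b x)).trans (map_add _ _ _)
  zero_smul f := LinearMap.ext fun x =>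
    (congrArg (show ResidueField R →ₗ[R] N from f) (zero_mul x)).trans (map_zero _)

/-- The local cohomology module `H^i_I(M)`. -/
noncomputable abbrev localH {R : Type u} [CommRing R] (I : Ideal R) (i : ℕ)
    (M : Type u) [AddCommGroup M] [Module R M] : ModuleCat.{u} R :=
  (localCohomology I i).obj (ModuleCat.of R M)

end LocalCM

/-! Write `H` for the bottom local cohomology module of `ω` along `I`, and `k` for the residue
field. Everything rests on describing the functors `Ext^i(-, ω)` on torsion modules.

Since `Ext^i(R/I, ω) = 0` for `i < c`, one can embed `c` times into injectives without `I`-torsion,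
and these are invisible to torsion modules. `exists_shift` thus produces `M'` with `Ext^i(N, M') ≅
Ext^(i+c)(N, ω)` for every `I`-torsion `N`. Hence `H` is the torsion submodule of `M'`, and `Hom(N,
H) ≅ Ext^c(N, ω)`; taking `N = H` gives the first isomorphism of (a).

The same shift along the maximal ideal, by `d` steps, yields a torsion module with one-dimensional
socle and no `Ext^1` from `k`, which must be `E`. So `Ext^d(-, ω)` is `Hom(-, E)` on torsion modules
(`exists_isDualizingClass`). The second isomorphism is local duality `Ext^i(N, ω) ≅ Hom(H^(d-i)(N),
E)` (`IsDualizingClass.nonempty_equiv`), needed for `N = H`, which is rarely finitely generated.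
Completeness makes this possible: for injective `Q`, all `Ext^i(Q/ΓQ, ω)` vanish
(`ext_quotient_torsionSub_subsingleton`), so only torsion contributes. Bass' bound on the injective
dimension of `ω` makes `d` the top degree.

For (b) and (c), let `X` be the module on the right of (a). Restriction to socles identifies `Hom(X,
E)` modulo the maximal ideal with the dual of the socle of `X`, and Nakayama's lemma in its complete
form lifts generators. In (c) the endomorphism ring is nonzero because `Hom(R/I, H) ≅ Ext^c(R/I, ω)`
is: otherwise Rees' and Ischebeck's theorems would raise the grade of `I` on `R` above `c`. -/

namespace LocalCM

open Limits Opposite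

variable {R : Type u} [CommRing R]

/-! ### Comparison of the derived-functor `Ext` with `Abelian.Ext`. -/

section Comparison

variable {A A' : ModuleCat.{u} R} (P : ProjectiveResolution A) (P' : ProjectiveResolution A')
  (B : ModuleCat.{u} R) (n : ℕ)

/-- The complex in the opposite category obtained by mapping a projective resolution to `B`. -/
noncomputable abbrev homOp : ChainComplex (ModuleCat.{u} R)ᵒᵖ ℕ :=
  (((linearYoneda R (ModuleCat.{u} R)).obj B).rightOp.mapHomologicalComplex _).obj P.complex

/-- The module of cocycles in `Hom (P_n, B)`. -/
noncomputable abbrev cocycleModule : ModuleCat.{u} R := unop ((homOp P B).opcycles n)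

/-- The inclusion of cocycles into `Hom (P_n, B)`. -/
noncomputable abbrev cocycleι : cocycleModule P B n →ₗ[R] (P.complex.X n ⟶ B) :=
  ((homOp P B).pOpcycles n).unop.hom

lemma cocycleι_injective : Function.Injective (cocycleι P B n) := by
  have : Mono ((homOp P B).pOpcycles n).unop := inferInstance
  exact (ModuleCat.mono_iff_injective _).1 this

lemma d_comp_cocycleι (z : cocycleModule P B n) :
    P.complex.d (n + 1) n ≫ cocycleι P B n z = 0 := by
  have h := (homOp P B).d_pOpcycles (n + 1) n
  have h2 := congrArg (fun f => f.unop.hom z) h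
  exact h2

lemma exists_cocycleι_eq (f : P.complex.X n ⟶ B) (hf : P.complex.d (n + 1) n ≫ f = 0) :
    ∃ z, cocycleι P B n z = f := by
  let S := ShortComplex.mk _ _ ((homOp P B).d_pOpcycles (n + 1) n)
  have hS : S.Exact := ShortComplex.exact_of_g_is_cokernel _
    ((homOp P B).opcyclesIsCokernel (n + 1) n (by simp))
  exact (ShortComplex.moduleCat_exact_iff _).1 hS.unop f hf

/-- The derived functor is computed by the projective resolution. -/
noncomputable def derivedIso :
    (((linearYoneda R (ModuleCat.{u} R)).obj B).rightOp.leftDerived n).obj A ≅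
      (homOp P B).homology n :=
  P.isoLeftDerivedObj ((linearYoneda R (ModuleCat.{u} R)).obj B).rightOp n

/-- The projection from cocycles to the derived functor `Ext`. -/
noncomputable abbrev cocycleπ :
    cocycleModule P B n →ₗ[R] ((Ext R (ModuleCat.{u} R) n).obj (op A)).obj B :=
  ((derivedIso P B n).hom ≫ (homOp P B).homologyι n).unop.hom

lemma cocycleπ_surjective : Function.Surjective (cocycleπ P B n) := by
  have : Epi ((derivedIso P B n).hom ≫ (homOp P B).homologyι n).unop := inferInstance
  exact (ModuleCat.epi_iff_surjective _).1 this

/-- The projection from cocycles to `Abelian.Ext`. -/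
noncomputable def cocycleExt : cocycleModule P B n →ₗ[R] Abelian.Ext A B n where
  toFun z := P.extMk (cocycleι P B n z) (n + 1) rfl (d_comp_cocycleι P B n z)
  map_add' x y := by
    rw [P.add_extMk]; congr 1; exact map_add _ _ _
  map_smul' r x := by
    rw [RingHom.id_apply, Abelian.Ext.smul_eq_comp_mk₀, P.extMk_comp_mk₀]
    congr 1
    rw [map_smul]
    ext; simp

lemma cocycleExt_surjective : Function.Surjective (cocycleExt P B n) := by
  intro e
  obtain ⟨f, hf, rfl⟩ := P.extMk_surjective e (n + 1) rfl
  obtain ⟨z, hz⟩ := exists_cocycleι_eq P B n f hf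
  refine ⟨z, ?_⟩
  simp only [cocycleExt, LinearMap.coe_mk, AddHom.coe_mk]
  congr 1

/-- The resolution has no term in cochain degree 1, so degree zero has no nonzero coboundaries. -/
lemma extMk_zero_eq_zero_iff (f : P.complex.X 0 ⟶ B) (hf : P.complex.d 1 0 ≫ f = 0) :
    P.extMk f 1 rfl hf = 0 ↔ f = 0 := by
  refine ⟨fun h => ?_, by rintro rfl; simp⟩
  rw [← P.extEquivCohomologyClass.apply_eq_iff_eq, P.extEquivCohomologyClass_extMk,
    P.extEquivCohomologyClass_zero, CochainComplex.HomComplex.CohomologyClass.mk_eq_zero_iff,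
    CochainComplex.HomComplex.Cocycle.toSingleMk_mem_coboundaries_iff _ _ _ _ _ 1 (by simp)] at h
  obtain ⟨g, hg⟩ := h
  have : g = 0 := (CochainComplex.isZero_of_isStrictlyLE P.cochainComplex 0 1 (by simp)).eq_of_src _ _
  rw [this, comp_zero] at hg
  rw [← cancel_epi (P.cochainComplexXIso (-0) 0 (by simp)).hom, comp_zero]
  exact hg.symm

/-- Both kernels are the coboundaries, so the two versions of `Ext` are quotients of one cocycle
module by the same submodule. -/
lemma ker_cocycleπ : LinearMap.ker (cocycleπ P B n) = LinearMap.ker (cocycleExt P B n) := by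
  have key : ∀ z, cocycleπ P B n z = 0 ↔ ∃ g, ((homOp P B).fromOpcycles n
      ((ComplexShape.down ℕ).next n)).unop.hom g = z := by
    intro z
    let S := ShortComplex.mk _ _ ((homOp P B).homologyι_comp_fromOpcycles n
      ((ComplexShape.down ℕ).next n))
    have hS : S.Exact := ShortComplex.exact_of_f_is_kernel _
      ((homOp P B).homologyIsKernel n _ rfl)
    have h1 := (ShortComplex.moduleCat_exact_iff _).1 hS.unop z
    let i := (derivedIso P B n).hom
    have hi : Function.Injective i.unop.hom := (ModuleCat.mono_iff_injective _).1 inferInstance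
    have h2 : cocycleπ P B n z = i.unop.hom (S.unop.g.hom z) := rfl
    constructor
    · intro h
      exact h1 (hi (by rw [← h2, h]; exact (map_zero _).symm))
    · rintro ⟨g, rfl⟩
      have h3 : S.unop.g.hom (S.unop.f.hom g) = 0 := by
        have := S.unop.zero
        exact congrArg (fun f => f.hom g) this
      exact h2.trans ((congrArg i.unop.hom h3).trans (map_zero i.unop.hom))
  have hp : ∀ g, cocycleι P B n (((homOp P B).fromOpcycles n
      ((ComplexShape.down ℕ).next n)).unop.hom g) =
      P.complex.d n ((ComplexShape.down ℕ).next n) ≫ g := by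
    intro g
    have := (homOp P B).p_fromOpcycles n ((ComplexShape.down ℕ).next n)
    exact congrArg (fun f => f.unop.hom g) this
  ext z
  rw [LinearMap.mem_ker, LinearMap.mem_ker, key]
  rcases n with _ | p
  -- In degree zero the default value `next 0 = 0` occurs, and the corresponding differential is
  -- zero.
  · have : (ComplexShape.down ℕ).next 0 = 0 := ChainComplex.next_nat_zero
    change _ ↔ P.extMk _ 1 rfl (d_comp_cocycleι P B 0 z) = 0
    rw [extMk_zero_eq_zero_iff]
    constructor
    · rintro ⟨g, rfl⟩
      rw [hp, P.complex.shape _ _ (by simp [this])]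
      exact zero_comp
    · intro h
      refine ⟨0, ?_⟩
      rw [map_zero]
      exact (cocycleι_injective P B 0 (by rw [h, map_zero])).symm
  · change _ ↔ P.extMk _ (p + 2) rfl (d_comp_cocycleι P B (p + 1) z) = 0
    rw [P.extMk_eq_zero_iff _ _ _ _ p rfl]
    have : (ComplexShape.down ℕ).next (p + 1) = p := ChainComplex.next_nat_succ p
    rw [this] at hp ⊢
    constructor
    · rintro ⟨g, rfl⟩
      exact ⟨g, (hp g).symm⟩
    · rintro ⟨g, hg⟩
      exact ⟨g, cocycleι_injective P B _ ((hp g).trans hg)⟩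

/-- Precomposing a cocycle with the lift `φ` computes the functoriality of both versions, so a
single `z'` serves for the two equations. -/
lemma cocycle_naturality {g : A' ⟶ A} (φ : ProjectiveResolution.Hom P' P g)
    (z : cocycleModule P B n) :
    ∃ z' : cocycleModule P' B n, cocycleπ P' B n z' =
        (((Ext R (ModuleCat.{u} R) n).map g.op).app B).hom (cocycleπ P B n z) ∧
      cocycleExt P' B n z' = (Abelian.Ext.mk₀ g).comp (cocycleExt P B n z) (zero_add n) := by
  let F := ((linearYoneda R (ModuleCat.{u} R)).obj B).rightOp
  let Φ := (F.mapHomologicalComplex _).map φ.hom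
  refine ⟨(HomologicalComplex.opcyclesMap Φ n).unop.hom z, ?_, ?_⟩
  · have h1 : (F.leftDerived n).map g ≫ (derivedIso P B n).hom =
        (derivedIso P' B n).hom ≫ HomologicalComplex.homologyMap Φ n :=
      ProjectiveResolution.isoLeftDerivedObj_hom_naturality g P' P φ.hom
        (by simpa using φ.hom_f_zero_comp_π_f_zero) F n
    have h2 : (F.leftDerived n).map g ≫ ((derivedIso P B n).hom ≫
        (homOp P B).homologyι n) = ((derivedIso P' B n).hom ≫
        (homOp P' B).homologyι n) ≫ HomologicalComplex.opcyclesMap Φ n := by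
      rw [Category.assoc, ← HomologicalComplex.homologyι_naturality, ← Category.assoc, h1,
        Category.assoc]
    have := congrArg (fun f => f.unop.hom z) h2
    exact this.symm
  · have h1 := HomologicalComplex.p_opcyclesMap Φ n
    have h2 := congrArg (fun f => f.unop.hom z) h1
    have h3 : cocycleι P' B n ((HomologicalComplex.opcyclesMap Φ n).unop.hom z) =
      φ.hom.f n ≫ cocycleι P B n z := h2
    change P'.extMk _ (n + 1) rfl (d_comp_cocycleι P' B n _) =
      (Abelian.Ext.mk₀ g).comp (P.extMk _ (n + 1) rfl (d_comp_cocycleι P B n z)) _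
    rw [ProjectiveResolution.mk₀_comp_extMk _ _ _ _ φ]
    congr 1

/-- The comparison between the derived functor `Ext` and `Abelian.Ext`. -/
noncomputable def extComparison (P : ProjectiveResolution A) (B : ModuleCat.{u} R) (n : ℕ) :
    ((Ext R (ModuleCat.{u} R) n).obj (op A)).obj B ≃ₗ[R] Abelian.Ext A B n :=
  ((cocycleπ P B n).quotKerEquivOfSurjective (cocycleπ_surjective P B n)).symm ≪≫ₗ
    Submodule.quotEquivOfEq _ _ (ker_cocycleπ P B n) ≪≫ₗ
    (cocycleExt P B n).quotKerEquivOfSurjective (cocycleExt_surjective P B n)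

lemma extComparison_cocycleπ (z : cocycleModule P B n) :
    extComparison P B n (cocycleπ P B n z) = cocycleExt P B n z := by
  have : ((cocycleπ P B n).quotKerEquivOfSurjective (cocycleπ_surjective P B n)).symm
      (cocycleπ P B n z) = Submodule.Quotient.mk z := by
    rw [LinearEquiv.symm_apply_eq]; rfl
  simp only [extComparison, LinearEquiv.trans_apply]
  rw [this]
  rfl

lemma extComparison_naturality {g : A' ⟶ A}
    (x : ((Ext R (ModuleCat.{u} R) n).obj (op A)).obj B) :
    extComparison P' B n ((((Ext R (ModuleCat.{u} R) n).map g.op).app B).hom x) =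
      (Abelian.Ext.mk₀ g).comp (extComparison P B n x) (zero_add n) := by
  obtain ⟨z, rfl⟩ := cocycleπ_surjective P B n x
  let φ : ProjectiveResolution.Hom P' P g :=
    ⟨ProjectiveResolution.lift g P' P, ProjectiveResolution.lift_commutes_zero g P' P⟩
  obtain ⟨z', h1, h2⟩ := cocycle_naturality P P' B n φ z
  rw [← h1, extComparison_cocycleπ, extComparison_cocycleπ, h2]

end Comparison
-- Local cohomology as an explicit direct limit.
/-- The projection `R ⧸ I ^ l ⟶ R ⧸ I ^ k` for `k ≤ l`. -/
noncomputable def powQuotMap (I : Ideal R) {k l : ℕ} (h : k ≤ l) :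
    ModuleCat.of R (R ⧸ I ^ l) ⟶ ModuleCat.of R (R ⧸ I ^ k) :=
  ModuleCat.ofHom (Submodule.mapQ _ _ LinearMap.id (Ideal.pow_le_pow_right h))

/-- The restriction map `Ext (R ⧸ I ^ k) M i → Ext (R ⧸ I ^ l) M i` for `k ≤ l`. -/
noncomputable abbrev extPowMap (I : Ideal R) (i : ℕ) (M : ModuleCat.{u} R) {k l : ℕ} (h : k ≤ l) :
    Abelian.Ext (ModuleCat.of R (R ⧸ I ^ k)) M i →ₗ[R]
      Abelian.Ext (ModuleCat.of R (R ⧸ I ^ l)) M i :=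
  (Abelian.Ext.mk₀ (powQuotMap I h)).precompOfLinear R M (zero_add i)

/-- `L` is the direct limit of the modules `Ext (R ⧸ I ^ k) M i`, with structure maps `ι k`. -/
structure IsLocalH (I : Ideal R) (i : ℕ) (M : ModuleCat.{u} R) {L : Type u} [AddCommGroup L]
    [Module R L] (ι : ∀ k : ℕ, Abelian.Ext (ModuleCat.of R (R ⧸ I ^ k)) M i →ₗ[R] L) : Prop where
  compat : ∀ {k l : ℕ} (h : k ≤ l) (e), ι l (extPowMap I i M h e) = ι k e
  surj : ∀ x, ∃ k e, ι k e = x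
  ker : ∀ k e, ι k e = 0 → ∃ l, ∃ h : k ≤ l, extPowMap I i M h e = 0

/-- The index category lives in universe 0 and the modules in `u`; shrinking the universe of the
preservation statement bridges the gap. -/
lemma forget_preservesColimit_nat (F : ℕᵒᵖᵒᵖ ⥤ ModuleCat.{u} R) :
    PreservesColimit F (forget (ModuleCat.{u} R)) := by
  have : PreservesFilteredColimitsOfSize.{0, 0} (forget (ModuleCat.{u} R)) :=
    preservesFilteredColimitsOfSize_shrink.{0, u, 0, u} _
  infer_instance

lemma exists_rep_of_isColimit (G : ℕᵒᵖᵒᵖ ⥤ ModuleCat.{u} R) (c : Cocone G) (hc : IsColimit c)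
    (x : c.pt) : ∃ k y, (c.ι.app (op (op k))).hom y = x := by
  have := forget_preservesColimit_nat G
  obtain ⟨k, y, hy⟩ := Concrete.isColimit_exists_rep G hc x
  exact ⟨k.unop.unop, y, hy⟩

lemma exists_map_eq_zero_of_isColimit (G : ℕᵒᵖᵒᵖ ⥤ ModuleCat.{u} R) (c : Cocone G)
    (hc : IsColimit c) (k : ℕ) (x : G.obj (op (op k))) (hx : (c.ι.app (op (op k))).hom x = 0) :
    ∃ l, ∃ h : k ≤ l, (G.map (homOfLE h).op.op).hom x = 0 := by
  have := forget_preservesColimit_nat G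
  have h0 : c.ι.app (op (op k)) x = c.ι.app (op (op k)) 0 := hx.trans (map_zero _).symm
  obtain ⟨l, f, g, hfg⟩ := Concrete.isColimit_exists_of_rep_eq G hc x 0 h0
  exact ⟨l.unop.unop, leOfHom f.unop.unop, hfg.trans (map_zero (G.map g).hom)⟩

/-- The diagram of the modules `Ext (R ⧸ I ^ k) M i`. -/
noncomputable abbrev extPowDiagram (I : Ideal R) (i : ℕ) (M : ModuleCat.{u} R) :
    ℕᵒᵖᵒᵖ ⥤ ModuleCat.{u} R :=
  localCohomology.diagram (localCohomology.idealPowersDiagram I) i ⋙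
    (evaluation (ModuleCat.{u} R) (ModuleCat.{u} R)).obj M

lemma exists_isColimit_localH (I : Ideal R) (i : ℕ) (M : Type u) [AddCommGroup M] [Module R M] :
    ∃ (c : Cocone (extPowDiagram I i (ModuleCat.of R M))), c.pt = localH I i M ∧
      Nonempty (IsColimit c) := by
  have := localCohomology.hasColimitDiagram.{u, 0} (localCohomology.idealPowersDiagram I) i
  exact ⟨((evaluation _ _).obj (ModuleCat.of R M)).mapCocone (colimit.cocone
    (localCohomology.diagram (localCohomology.idealPowersDiagram I) i)), rfl,
    ⟨isColimitOfPreserves _ (colimit.isColimit _)⟩⟩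

lemma exists_isLocalH_of_isColimit (I : Ideal R) (i : ℕ) (M : ModuleCat.{u} R)
    (c : Cocone (extPowDiagram I i M)) (hc : IsColimit c) :
    ∃ ι : ∀ k : ℕ, Abelian.Ext (ModuleCat.of R (R ⧸ I ^ k)) M i →ₗ[R] c.pt,
      IsLocalH I i M ι := by
  let P : ∀ k : ℕ, ProjectiveResolution (ModuleCat.of R (R ⧸ I ^ k)) :=
    fun k => projectiveResolution _
  let cmp : ∀ k : ℕ, (extPowDiagram I i M).obj (op (op k)) ≃ₗ[R]
    Abelian.Ext (ModuleCat.of R (R ⧸ I ^ k)) M i := fun k => extComparison (P k) M i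
  have hnat : ∀ {k l : ℕ} (h : k ≤ l) (x),
      cmp l (((extPowDiagram I i M).map (homOfLE h).op.op).hom x) =
        extPowMap I i _ h (cmp k x) := by
    intro k l h x
    exact extComparison_naturality (P k) (P l) M i x
  have hj : ∀ {k l : ℕ} (h : k ≤ l) (x), (c.ι.app (op (op l))).hom
      (((extPowDiagram I i M).map (homOfLE h).op.op).hom x) = (c.ι.app (op (op k))).hom x := by
    intro k l h x
    have := c.w (homOfLE h).op.op
    exact congrArg (fun f => f.hom x) this
  refine ⟨fun k => (c.ι.app (op (op k))).hom ∘ₗ (cmp k).symm.toLinearMap, ?_, ?_, ?_⟩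
  · intro k l h e
    obtain ⟨x, rfl⟩ := (cmp k).surjective e
    rw [← hnat h x]
    simp only [LinearMap.comp_apply, LinearEquiv.coe_coe, LinearEquiv.symm_apply_apply]
    exact hj h x
  · intro x
    obtain ⟨k, y, hy⟩ := exists_rep_of_isColimit _ c hc x
    exact ⟨k, cmp _ y, by
      simpa only [LinearMap.comp_apply, LinearEquiv.coe_coe, LinearEquiv.symm_apply_apply] using hy⟩
  · intro k e he
    obtain ⟨x, rfl⟩ := (cmp k).surjective e
    simp only [LinearMap.comp_apply, LinearEquiv.coe_coe, LinearEquiv.symm_apply_apply] at he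
    obtain ⟨l, h, hl⟩ := exists_map_eq_zero_of_isColimit _ c hc k x he
    exact ⟨l, h, by rw [← hnat, hl, map_zero]⟩

lemma exists_isLocalH (I : Ideal R) (i : ℕ) (M : Type u) [AddCommGroup M] [Module R M] :
    ∃ ι : ∀ k : ℕ, Abelian.Ext (ModuleCat.of R (R ⧸ I ^ k)) (ModuleCat.of R M) i →ₗ[R]
      localH I i M, IsLocalH I i (ModuleCat.of R M) ι := by
  obtain ⟨c, h, ⟨hc⟩⟩ := exists_isColimit_localH I i M
  rw [← h]
  exact exists_isLocalH_of_isColimit I i _ c hc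

namespace IsLocalH

variable {I : Ideal R} {i : ℕ} {M : ModuleCat.{u} R} {L : Type u} [AddCommGroup L] [Module R L]
  {ι : ∀ k : ℕ, Abelian.Ext (ModuleCat.of R (R ⧸ I ^ k)) M i →ₗ[R] L}
  (hL : IsLocalH I i M ι) {L' : Type u} [AddCommGroup L'] [Module R L']

include hL

lemma exists_desc (φ : ∀ k : ℕ, Abelian.Ext (ModuleCat.of R (R ⧸ I ^ k)) M i →ₗ[R] L')
    (hφ : ∀ {k l : ℕ} (h : k ≤ l) (e), φ l (extPowMap I i M h e) = φ k e) :
    ∃ Φ : L →ₗ[R] L', ∀ k e, Φ (ι k e) = φ k e := by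
  -- Two representatives of one element are compared at level `max k l`; their difference dies at
  -- some later level, where `φ` sees it too.
  have wd : ∀ k e l e', ι k e = ι l e' → φ k e = φ l e' := by
    intro k e l e' h
    let m := max k l
    have h1 : ι m (extPowMap I i M (le_max_left k l) e - extPowMap I i M (le_max_right k l) e') = 0 := by
      rw [map_sub, hL.compat, hL.compat, h, sub_self]
    obtain ⟨n, hn, h2⟩ := hL.ker _ _ h1
    have h3 := congrArg (φ n) h2
    rw [hφ, map_sub, hφ, hφ, map_zero, sub_eq_zero] at h3
    exact h3
  choose K e he using hL.surj
  refine ⟨⟨⟨fun x => φ (K x) (e x), ?_⟩, ?_⟩, ?_⟩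
  · intro x y
    have := wd (K (x + y)) (e (x + y)) (max (K x) (K y)) (extPowMap I i M (le_max_left _ _) (e x) +
      extPowMap I i M (le_max_right _ _) (e y)) (by
        rw [map_add, hL.compat, hL.compat, he, he, he])
    rw [this, map_add, hφ, hφ]
  · intro r x
    change φ _ _ = r • φ _ _
    rw [← map_smul]
    exact wd _ _ _ _ (by rw [map_smul, he, he])
  · intro k a
    exact wd _ _ _ _ (he _)

lemma nonempty_equiv {j : ℕ} {M' : ModuleCat.{u} R}
    {ι' : ∀ k : ℕ, Abelian.Ext (ModuleCat.of R (R ⧸ I ^ k)) M' j →ₗ[R] L'}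
    (hL' : IsLocalH I j M' ι')
    (φ : ∀ k, Abelian.Ext (ModuleCat.of R (R ⧸ I ^ k)) M i →ₗ[R]
      Abelian.Ext (ModuleCat.of R (R ⧸ I ^ k)) M' j)
    (hφ : ∀ k, Function.Bijective (φ k))
    (hc : ∀ {k l : ℕ} (h : k ≤ l) (e), φ l (extPowMap I i M h e) = extPowMap I j M' h (φ k e)) :
    Nonempty (L ≃ₗ[R] L') := by
  obtain ⟨Φ, hΦ⟩ := hL.exists_desc (fun k => ι' k ∘ₗ φ k) (by
    intro k l h e
    simp only [LinearMap.comp_apply]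
    rw [hc, hL'.compat])
  refine ⟨LinearEquiv.ofBijective Φ ⟨?_, ?_⟩⟩
  · rw [← LinearMap.ker_eq_bot, LinearMap.ker_eq_bot']
    intro x hx
    obtain ⟨k, e, rfl⟩ := hL.surj x
    rw [hΦ] at hx
    obtain ⟨l, h, hl⟩ := hL'.ker _ _ hx
    rw [← hc, map_eq_zero_iff _ (hφ l).1] at hl
    rw [← hL.compat h, hl, map_zero]
  · intro x
    obtain ⟨k, e, rfl⟩ := hL'.surj x
    obtain ⟨e, rfl⟩ := (hφ k).2 e
    exact ⟨ι k e, hΦ _ _⟩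

end IsLocalH

end LocalCM

namespace LocalCM

open Limits Opposite Abelian

variable {R : Type u} [CommRing R]

/-! ### Short exact sequences, torsion submodules and dimension shifting. -/

section ShortExact

variable {M : Type u} [AddCommGroup M] [Module R M]

/-- The short complex `P ⟶ M ⟶ M ⧸ P` attached to a submodule. -/
noncomputable abbrev subSES (P : Submodule R M) : ShortComplex (ModuleCat.{u} R) :=
  ShortComplex.mk (ModuleCat.ofHom P.subtype) (ModuleCat.ofHom P.mkQ) (by
    ext x; simp)

lemma subSES_shortExact (P : Submodule R M) : (subSES P).ShortExact where
  exact := (ShortComplex.moduleCat_exact_iff _).2 fun x hx =>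
    ⟨⟨x, by simpa using hx⟩, rfl⟩
  mono_f := (ModuleCat.mono_iff_injective _).2 P.subtype_injective
  epi_g := (ModuleCat.epi_iff_surjective _).2 P.mkQ_surjective

/-- The short complex of an injective linear map and its cokernel. -/
noncomputable abbrev cokerSES {N : Type u} [AddCommGroup N] [Module R N] (f : M →ₗ[R] N) :
    ShortComplex (ModuleCat.{u} R) :=
  ShortComplex.mk (ModuleCat.ofHom f) (ModuleCat.ofHom (LinearMap.range f).mkQ) (by
    ext x; simp)

lemma cokerSES_shortExact {N : Type u} [AddCommGroup N] [Module R N] (f : M →ₗ[R] N)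
    (hf : Function.Injective f) : (cokerSES f).ShortExact where
  exact := (ShortComplex.moduleCat_exact_iff _).2 fun x hx => by
    have : x ∈ LinearMap.range f := by simpa using hx
    exact this
  mono_f := (ModuleCat.mono_iff_injective _).2 hf
  epi_g := (ModuleCat.epi_iff_surjective _).2 (Submodule.mkQ_surjective _)

end ShortExact

section Torsion

variable (I : Ideal R) (M : Type u) [AddCommGroup M] [Module R M]

/-- The submodule of elements annihilated by a power of `I`. -/
def torsionSub : Submodule R M where
  carrier := {x | ∃ n : ℕ, ∀ a ∈ I ^ n, a • x = 0}
  zero_mem' := ⟨0, fun a _ => smul_zero a⟩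
  add_mem' := by
    rintro x y ⟨m, hm⟩ ⟨n, hn⟩
    refine ⟨max m n, fun a ha => ?_⟩
    rw [smul_add, hm a (Ideal.pow_le_pow_right (le_max_left m n) ha),
      hn a (Ideal.pow_le_pow_right (le_max_right m n) ha), add_zero]
  smul_mem' := by
    rintro r x ⟨n, hn⟩
    exact ⟨n, fun a ha => by rw [smul_comm, hn a ha, smul_zero]⟩

/-- A module is `I`-torsion if each element is annihilated by a power of `I`. -/
def IsTorsion : Prop := ∀ x : M, ∃ n : ℕ, ∀ a ∈ I ^ n, a • x = 0

variable {I M}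

lemma isTorsion_torsionSub : IsTorsion I (torsionSub I M) := by
  rintro ⟨x, n, hn⟩
  exact ⟨n, fun a ha => Subtype.ext (hn a ha)⟩

lemma IsTorsion.of_injective {N : Type u} [AddCommGroup N] [Module R N] (hN : IsTorsion I N)
    (f : M →ₗ[R] N) (hf : Function.Injective f) : IsTorsion I M := fun x => by
  obtain ⟨n, hn⟩ := hN (f x)
  exact ⟨n, fun a ha => hf (by rw [map_smul, hn a ha, map_zero])⟩

lemma IsTorsion.of_surjective {N : Type u} [AddCommGroup N] [Module R N] (hM : IsTorsion I M)
    (f : M →ₗ[R] N) (hf : Function.Surjective f) : IsTorsion I N := fun y => by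
  obtain ⟨x, rfl⟩ := hf y
  obtain ⟨n, hn⟩ := hM x
  exact ⟨n, fun a ha => by rw [← map_smul, hn a ha, map_zero]⟩

lemma IsTorsion.map_mem {N : Type u} [AddCommGroup N] [Module R N] (hM : IsTorsion I M)
    (f : M →ₗ[R] N) (x : M) : f x ∈ torsionSub I N := by
  obtain ⟨n, hn⟩ := hM x
  exact ⟨n, fun a ha => by rw [← map_smul, hn a ha, map_zero]⟩

lemma isTorsion_quotient_pow (I : Ideal R) (k : ℕ) : IsTorsion I (R ⧸ I ^ k) := by
  intro x
  refine ⟨k, fun a ha => ?_⟩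
  obtain ⟨r, rfl⟩ := Submodule.Quotient.mk_surjective _ x
  rw [← Submodule.Quotient.mk_smul, Submodule.Quotient.mk_eq_zero]
  exact Ideal.mul_mem_right _ _ ha

lemma isTorsion_quotient (I : Ideal R) : IsTorsion I (R ⧸ I) := by
  intro x
  refine ⟨1, fun a ha => ?_⟩
  obtain ⟨r, rfl⟩ := Submodule.Quotient.mk_surjective _ x
  rw [← Submodule.Quotient.mk_smul, Submodule.Quotient.mk_eq_zero]
  rw [pow_one] at ha
  exact Ideal.mul_mem_right _ _ ha

/-- An `I`-torsion module with no nonzero element killed by `I` vanishes. -/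
lemma eq_zero_of_forall_smul_eq_zero (h : ∀ x : M, (∀ a ∈ I, a • x = 0) → x = 0) {x : M}
    (hx : x ∈ torsionSub I M) : x = 0 := by
  obtain ⟨n, hn⟩ := hx
  induction n generalizing x with
  | zero => simpa using hn 1 (by simp)
  | succ n ih =>
    refine h x fun a ha => ih fun b hb => ?_
    rw [smul_smul]
    exact hn _ (by rw [pow_succ]; exact Ideal.mul_mem_mul hb ha)

lemma torsionSub_eq_bot (h : ∀ x : M, (∀ a ∈ I, a • x = 0) → x = 0) : torsionSub I M = ⊥ :=
  eq_bot_iff.2 fun _ hx => eq_zero_of_forall_smul_eq_zero h hx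

/-- `I ^ n` is finitely generated, so one power `I ^ K` kills all products of its generators with
`m`; then `I ^ (K + n)` kills `m`. -/
lemma torsionSub_quotient_torsionSub [IsNoetherianRing R] :
    torsionSub I (M ⧸ torsionSub I M) = ⊥ := by
  rw [eq_bot_iff]
  rintro x ⟨n, hn⟩
  obtain ⟨m, rfl⟩ := Submodule.Quotient.mk_surjective _ x
  rw [Submodule.mem_bot, Submodule.Quotient.mk_eq_zero]
  have h1 : ∀ a ∈ I ^ n, ∃ k : ℕ, ∀ b ∈ I ^ k, b • a • m = 0 := by
    intro a ha
    have := hn a ha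
    rwa [← Submodule.Quotient.mk_smul, Submodule.Quotient.mk_eq_zero] at this
  obtain ⟨s, hs⟩ := IsNoetherian.noetherian (I ^ n)
  have hfin : ∃ K : ℕ, ∀ a ∈ s, ∀ b ∈ I ^ K, b • a • m = 0 := by
    have h2 : ∀ a ∈ s, ∃ k : ℕ, ∀ b ∈ I ^ k, b • a • m = 0 := fun a ha =>
      h1 a (by rw [← hs]; exact Submodule.subset_span ha)
    choose! k hk using h2
    refine ⟨s.sup k, fun a ha b hb => hk a ha b (Ideal.pow_le_pow_right (Finset.le_sup ha) hb)⟩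
  obtain ⟨K, hK⟩ := hfin
  refine ⟨K + n, fun a ha => ?_⟩
  rw [pow_add] at ha
  refine Submodule.mul_induction_on ha (fun b hb a' ha' => ?_) (fun x y hx hy => by
    rw [add_smul, hx, hy, add_zero])
  rw [mul_smul]
  rw [← hs] at ha'
  refine Submodule.span_induction (p := fun a' _ => b • a' • m = 0) (fun x hx => hK x hx b hb)
    (by simp) (fun x y _ _ hx hy => by rw [add_smul, smul_add, hx, hy, add_zero])
    (fun r x _ hx => by rw [smul_assoc, smul_comm b r, hx, smul_zero]) ha'

lemma exists_quotient_map (J : Ideal R) (x : M) (hx : ∀ a ∈ J, a • x = 0) :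
    ∃ f : (R ⧸ J) →ₗ[R] M, f (Submodule.Quotient.mk 1) = x :=
  ⟨Submodule.liftQ _ (LinearMap.toSpanSingleton R M x) fun a ha => hx a ha, one_smul R x⟩

lemma quotient_hom_ext {J : Ideal R} {f g : (R ⧸ J) →ₗ[R] M}
    (h : f (Submodule.Quotient.mk 1) = g (Submodule.Quotient.mk 1)) : f = g := by
  refine LinearMap.ext fun x => ?_
  obtain ⟨r, rfl⟩ := Submodule.Quotient.mk_surjective _ x
  have h2 : (Submodule.Quotient.mk r : R ⧸ J) = r • Submodule.Quotient.mk 1 := by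
    rw [← Submodule.Quotient.mk_smul, smul_eq_mul, mul_one]
  rw [h2, map_smul, map_smul, h]

lemma exists_pow_of_fg {N : Type u} [AddCommGroup N] [Module R N] [Module.Finite R N]
    (hN : IsTorsion I N) : ∃ n : ℕ, ∀ a ∈ I ^ n, ∀ x : N, a • x = 0 := by
  obtain ⟨s, hs⟩ := Module.Finite.fg_top (R := R) (M := N)
  choose k hk using hN
  refine ⟨s.sup k, fun a ha x => ?_⟩
  have : x ∈ Submodule.span R (s : Set N) := by rw [hs]; trivial
  refine Submodule.span_induction (p := fun x _ => a • x = 0) (fun x hx => hk x a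
    (Ideal.pow_le_pow_right (Finset.le_sup hx) ha)) (smul_zero a)
    (fun x y _ _ hx hy => by rw [smul_add, hx, hy, add_zero])
    (fun r x _ hx => by rw [smul_comm, hx, smul_zero]) this

/-- The torsion submodule of an injective module over a Noetherian ring is injective. -/
theorem injective_torsionSub [IsNoetherianRing R] (hM : Module.Injective R M) :
    Module.Injective R (torsionSub I M) := by
  refine Module.Baer.injective fun J g => ?_
  have : Module.Finite R J := Module.Finite.iff_fg.2 (IsNoetherian.noetherian J)
  have hrange : IsTorsion I (LinearMap.range g) :=
    isTorsion_torsionSub.of_injective (LinearMap.range g).subtype (Submodule.subtype_injective _)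
  obtain ⟨n, hn⟩ := exists_pow_of_fg hrange
  -- By Artin–Rees, `J ⊓ I ^ (n + k)` lies in `I ^ n • J`, which `g` kills. So `g` descends to a
  -- submodule of `R ⧸ K`, and any extension to that torsion module has torsion values.
  obtain ⟨k, hk⟩ := Ideal.exists_pow_inf_eq_pow_smul I (J : Submodule R R)
  let K := I ^ (n + k)
  have hgK : ∀ x : J, (x : R) ∈ K → g x = 0 := by
    intro x hx
    have h1 : (x : R) ∈ I ^ n • (J : Submodule R R) := by
      have h2 : (x : R) ∈ I ^ (n + k) • (⊤ : Submodule R R) ⊓ (J : Submodule R R) :=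
        ⟨by simpa using hx, x.2⟩
      rw [hk (n + k) (Nat.le_add_left k n), Nat.add_sub_cancel] at h2
      exact Submodule.smul_mono le_rfl inf_le_right h2
    have h3 : I ^ n • (J : Submodule R R) =
        Submodule.map J.subtype (I ^ n • (⊤ : Submodule R J)) := by
      rw [Submodule.map_smul'', Submodule.map_subtype_top]
    rw [h3] at h1
    obtain ⟨y, hy, hyx⟩ := h1
    obtain rfl : y = x := Subtype.ext hyx
    refine Submodule.smul_induction_on (p := fun y => g y = 0) hy ?_ ?_
    · intro r hr z _
      rw [map_smul]
      exact congrArg Subtype.val (hn r hr ⟨g z, z, rfl⟩)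
    · intro y z hy hz
      rw [map_add, hy, hz, add_zero]
  let f : (J ⧸ Submodule.comap J.subtype K) →ₗ[R] (R ⧸ K) :=
    Submodule.mapQ _ _ J.subtype le_rfl
  have hf : Function.Injective f := by
    rw [← LinearMap.ker_eq_bot, LinearMap.ker_eq_bot']
    intro x hx
    obtain ⟨x, rfl⟩ := Submodule.Quotient.mk_surjective _ x
    rw [Submodule.mapQ_apply, Submodule.Quotient.mk_eq_zero] at hx
    rw [Submodule.Quotient.mk_eq_zero]
    exact hx
  obtain ⟨h, hh⟩ := hM.out f hf (Submodule.liftQ _ ((torsionSub I M).subtype ∘ₗ g) (by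
    intro x hx
    rw [LinearMap.mem_ker, LinearMap.comp_apply, hgK x hx, map_zero]))
  refine ⟨LinearMap.codRestrict _ (h ∘ₗ Submodule.mkQ K) fun x =>
    (isTorsion_quotient_pow I (n + k)).map_mem h _, fun x hx => Subtype.ext ?_⟩
  exact hh (Submodule.Quotient.mk ⟨x, hx⟩)

/-- The torsion submodule is injective, hence a direct summand, so the quotient is a retract of `Q`.
-/
lemma injective_quotient_torsionSub [IsNoetherianRing R] (I : Ideal R) {Q : Type u}
    [AddCommGroup Q] [Module R Q] (hQ : Module.Injective R Q) :
    Module.Injective R (Q ⧸ torsionSub I Q) := by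
  have hΓ := injective_torsionSub (I := I) hQ
  obtain ⟨p, hp⟩ := hΓ.out (torsionSub I Q).subtype (Submodule.subtype_injective _) LinearMap.id
  let s : (Q ⧸ torsionSub I Q) →ₗ[R] Q := Submodule.liftQ _
    (LinearMap.id - (torsionSub I Q).subtype ∘ₗ p) (by
      intro x hx
      have := hp ⟨x, hx⟩
      simp only [Submodule.subtype_apply, LinearMap.id_apply] at this
      simp [this])
  have hs : ∀ x, (torsionSub I Q).mkQ (s x) = x := by
    intro x
    obtain ⟨x, rfl⟩ := Submodule.Quotient.mk_surjective _ x
    simp [s]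
  refine ⟨fun X Y _ _ _ _ i hi g => ?_⟩
  obtain ⟨h, hh⟩ := hQ.out i hi (s ∘ₗ g)
  exact ⟨(torsionSub I Q).mkQ ∘ₗ h, fun x => by
    rw [LinearMap.comp_apply, hh, LinearMap.comp_apply, hs]⟩

/-- A module without `I`-torsion embeds into an injective module without `I`-torsion. -/
theorem exists_injective_torsionSub_eq_bot [IsNoetherianRing R] (I : Ideal R) (M : Type u)
    [AddCommGroup M] [Module R M] (h : torsionSub I M = ⊥) :
    ∃ (Q : ModuleCat.{u} R) (f : M →ₗ[R] Q), Module.Injective R Q ∧ Function.Injective f ∧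
      torsionSub I Q = ⊥ := by
  obtain ⟨⟨Q, hQ, f, hf⟩⟩ := EnoughInjectives.presentation (ModuleCat.of R M)
  have hQ' : Module.Injective R Q := (Module.injective_iff_injective_object R Q).2 hQ
  have hf' : Function.Injective f.hom := (ModuleCat.mono_iff_injective _).1 hf
  -- Dividing an injective overmodule by its torsion loses nothing of `M`, because `M` meets that
  -- torsion only in its own, which is zero.
  refine ⟨ModuleCat.of R (Q ⧸ torsionSub I Q), (torsionSub I Q).mkQ ∘ₗ f.hom,
    injective_quotient_torsionSub I hQ', ?_, torsionSub_quotient_torsionSub⟩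
  rw [← LinearMap.ker_eq_bot, LinearMap.ker_eq_bot']
  intro x hx
  simp only [LinearMap.comp_apply, Submodule.mkQ_apply, Submodule.Quotient.mk_eq_zero] at hx
  obtain ⟨n, hn⟩ := hx
  have : x ∈ torsionSub I M := ⟨n, fun a ha => hf' (by rw [map_smul, map_zero]; exact hn a ha)⟩
  rwa [h, Submodule.mem_bot] at this

lemma ext_subsingleton_of_injective (N Q : ModuleCat.{u} R) (hQ : Module.Injective R Q) (i : ℕ)
    (hi : 0 < i) : Subsingleton (Ext N Q i) := by
  have : Injective Q := (Module.injective_iff_injective_object R Q).1 hQ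
  obtain ⟨i, rfl⟩ : ∃ j, i = j + 1 := ⟨i - 1, by omega⟩
  exact Ext.subsingleton_of_injective N Q i

/-- `Hom (N, M)` as the module of extensions of degree zero. -/
noncomputable def extZeroEquiv (N M : ModuleCat.{u} R) : Ext N M 0 ≃ₗ[R] (N →ₗ[R] M) :=
  Ext.linearEquiv₀ ≪≫ₗ ModuleCat.homLinearEquiv

lemma extZeroEquiv_mk₀ {N M : ModuleCat.{u} R} (f : N →ₗ[R] M) :
    extZeroEquiv N M (Ext.mk₀ (ModuleCat.ofHom f)) = f :=
  (extZeroEquiv N M).apply_symm_apply f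

lemma exists_mk₀_eq {N M : ModuleCat.{u} R} (e : Ext N M 0) :
    ∃ f : N →ₗ[R] M, Ext.mk₀ (ModuleCat.ofHom f) = e :=
  (extZeroEquiv N M).symm.surjective e

lemma ext_subsingleton_of_torsion [IsNoetherianRing R] (N Q : ModuleCat.{u} R) (hN : IsTorsion I N)
    (hQ : Module.Injective R Q) (hΓ : torsionSub I Q = ⊥) (i : ℕ) : Subsingleton (Ext N Q i) := by
  rcases Nat.eq_zero_or_pos i with rfl | hi
  · refine (extZeroEquiv N Q).toEquiv.subsingleton_congr.2 ⟨fun f g => ?_⟩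
    ext x
    have h1 := hN.map_mem (f - g) x
    rw [hΓ, Submodule.mem_bot] at h1
    exact sub_eq_zero.1 h1
  · exact ext_subsingleton_of_injective N Q hQ i hi

lemma torsionSub_eq_bot_of_ext {M : ModuleCat.{u} R}
    (h : Subsingleton (Ext (ModuleCat.of R (R ⧸ I)) M 0)) : torsionSub I M = ⊥ := by
  have h' : Subsingleton ((R ⧸ I) →ₗ[R] M) := (extZeroEquiv _ M).toEquiv.subsingleton_congr.1 h
  refine torsionSub_eq_bot fun x hx => ?_
  obtain ⟨f, rfl⟩ := exists_quotient_map I x hx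
  rw [Subsingleton.elim f 0, LinearMap.zero_apply]

/-- Dimension shifting for torsion modules: if `Ext^i (R/I, M)` vanishes for `i < c`, then the
functors `Ext^(i+c) (-, M)` on `I`-torsion modules are the functors `Ext^i (-, M')`. -/
theorem exists_shift [IsNoetherianRing R] (I : Ideal R) (c : ℕ) (M : ModuleCat.{u} R)
    (h : ∀ i < c, Subsingleton (Ext (ModuleCat.of R (R ⧸ I)) M i)) :
    ∃ (M' : ModuleCat.{u} R) (ε : Ext M' M c), ∀ N : ModuleCat.{u} R, IsTorsion I N →
      (∀ i < c, Subsingleton (Ext N M i)) ∧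
      ∀ i j (hij : i + c = j), Function.Bijective (fun e : Ext N M' i => e.comp ε hij) := by
  induction c generalizing M with
  | zero =>
    refine ⟨M, Ext.mk₀ (𝟙 M), fun N hN => ⟨by simp, ?_⟩⟩
    rintro i j rfl
    simp only [Ext.comp_mk₀_id]
    exact Function.bijective_id
  | succ c ih =>
    -- Torsion modules have no `Ext` into `Q` in any degree, zero included, so the connecting map is
    -- bijective throughout. The class `ε` is the product of the successive connecting classes.
    obtain ⟨Q, f, hQ, hf, hΓ⟩ := exists_injective_torsionSub_eq_bot I M
      (torsionSub_eq_bot_of_ext (h 0 (Nat.succ_pos c)))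
    let S := cokerSES f
    have hS : S.ShortExact := cokerSES_shortExact f hf
    have hbij : ∀ N : ModuleCat.{u} R, IsTorsion I N → ∀ i j (hij : i + 1 = j),
        Function.Bijective (fun e : Ext N S.X₃ i => e.comp hS.extClass hij) := by
      intro N hN i j hij
      have hz : ∀ i, Subsingleton (Ext N S.X₂ i) := ext_subsingleton_of_torsion N Q hN hQ hΓ
      constructor
      · intro x y hxy
        have h0 : (x - y).comp hS.extClass hij = 0 := by
          rw [sub_eq_add_neg, Ext.add_comp, Ext.neg_comp, ← sub_eq_add_neg, sub_eq_zero]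
          exact hxy
        obtain ⟨z, hz'⟩ := Ext.covariant_sequence_exact₃ N hS _ hij h0
        rw [(hz i).elim z 0, Ext.zero_comp] at hz'
        exact sub_eq_zero.1 hz'.symm
      · intro y
        exact Ext.covariant_sequence_exact₁ N hS y ((hz j).elim _ _) hij
    obtain ⟨M', ε, hε⟩ := ih S.X₃ (fun i hi => by
      have hb := hbij (ModuleCat.of R (R ⧸ I)) (isTorsion_quotient I) i (i + 1) rfl
      have := h (i + 1) (by omega)
      exact hb.1.subsingleton)
    refine ⟨M', ε.comp hS.extClass rfl, fun N hN => ⟨?_, ?_⟩⟩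
    · intro i hi
      rcases i with _ | i
      · have := ext_subsingleton_of_torsion N Q hN hQ hΓ 0
        have hinj := Ext.postcomp_mk₀_injective_of_mono N S.f (hf := hS.mono_f)
        exact hinj.subsingleton
      · have := (hε N hN).1 i (by omega)
        exact (hbij N hN i (i + 1) rfl).2.subsingleton
    · intro i j hij
      have h1 := (hε N hN).2 i (i + c) rfl
      have h2 := hbij N hN (i + c) j (by omega)
      have h3 := h2.comp h1
      convert h3 using 1
      funext e
      exact (Ext.comp_assoc e ε hS.extClass rfl rfl (by omega)).symm

/-- Local cohomology in degree zero is the torsion submodule. -/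
theorem isLocalH_zero (I : Ideal R) (M : ModuleCat.{u} R) :
    ∃ ι : ∀ k : ℕ, Ext (ModuleCat.of R (R ⧸ I ^ k)) M 0 →ₗ[R] torsionSub I M,
      IsLocalH I 0 M ι ∧ ∀ k (f : (R ⧸ I ^ k) →ₗ[R] M),
        (ι k (Ext.mk₀ (ModuleCat.ofHom f)) : M) = f (Submodule.Quotient.mk 1) := by
  let ev : ∀ k : ℕ, ((R ⧸ I ^ k) →ₗ[R] M) →ₗ[R] torsionSub I M := fun k =>
    { toFun := fun f => ⟨f (Submodule.Quotient.mk 1), (isTorsion_quotient_pow I k).map_mem f _⟩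
      map_add' := fun f g => rfl
      map_smul' := fun r f => rfl }
  have hev : ∀ k, Function.Injective (ev k) := fun k f g h =>
    quotient_hom_ext (congrArg Subtype.val h)
  refine ⟨fun k => ev k ∘ₗ (extZeroEquiv _ M).toLinearMap, ⟨?_, ?_, ?_⟩, ?_⟩
  · intro k l h e
    obtain ⟨f, rfl⟩ := exists_mk₀_eq e
    have : extPowMap I 0 M h (Ext.mk₀ (ModuleCat.ofHom f)) =
        Ext.mk₀ (ModuleCat.ofHom (f ∘ₗ (powQuotMap I h).hom)) := by
      change (Ext.mk₀ (powQuotMap I h)).comp (Ext.mk₀ (ModuleCat.ofHom f)) (zero_add 0) = _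
      rw [Ext.mk₀_comp_mk₀]
      rfl
    simp only [this, LinearMap.comp_apply, LinearEquiv.coe_coe]
    rw [extZeroEquiv_mk₀, extZeroEquiv_mk₀]
    rfl
  · rintro ⟨x, k, hk⟩
    obtain ⟨f, rfl⟩ := exists_quotient_map _ x hk
    refine ⟨k, Ext.mk₀ (ModuleCat.ofHom f), ?_⟩
    simp only [LinearMap.comp_apply, LinearEquiv.coe_coe]
    rw [extZeroEquiv_mk₀]
    rfl
  · intro k e he
    obtain rfl : e = 0 := (extZeroEquiv _ M).injective (hev k (by simpa using he))
    exact ⟨k, le_rfl, map_zero _⟩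
  · intro k f
    simp only [LinearMap.comp_apply, LinearEquiv.coe_coe]
    rw [extZeroEquiv_mk₀]
    rfl

end Torsion
end LocalCM

namespace LocalCM

open Limits Opposite Abelian

variable {R : Type u} [CommRing R]

/-! ### Vanishing of `Ext`: the theorems of Rees and Ischebeck. -/

section ExtLemmas

lemma ext_subsingleton_X₂_left {S : ShortComplex (ModuleCat.{u} R)} (hS : S.ShortExact)
    (M : ModuleCat.{u} R) (i : ℕ) (h₁ : Subsingleton (Ext S.X₁ M i))
    (h₃ : Subsingleton (Ext S.X₃ M i)) : Subsingleton (Ext S.X₂ M i) := by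
  refine subsingleton_of_forall_eq 0 fun x => ?_
  obtain ⟨y, rfl⟩ := Ext.contravariant_sequence_exact₂ hS M x (h₁.elim _ _)
  rw [h₃.elim y 0, Ext.comp_zero]

lemma ext_subsingleton_of_equiv {N N' : ModuleCat.{u} R} (e : N ≃ₗ[R] N') (M : ModuleCat.{u} R)
    (i : ℕ) (h : Subsingleton (Ext N M i)) : Subsingleton (Ext N' M i) := by
  refine subsingleton_of_forall_eq 0 fun x => ?_
  have h1 : (Ext.mk₀ e.toModuleIso.inv).comp ((Ext.mk₀ e.toModuleIso.hom).comp x (zero_add i))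
      (zero_add i) = x := by
    rw [Ext.mk₀_comp_mk₀_assoc, Iso.inv_hom_id, Ext.mk₀_id_comp]
  rw [← h1, h.elim ((Ext.mk₀ e.toModuleIso.hom).comp x (zero_add i)) 0, Ext.comp_zero]

lemma smul_comp_mk₀ {N M : ModuleCat.{u} R} {i : ℕ} (e : Ext N M i) (r : R) :
    e.comp (Ext.mk₀ (r • 𝟙 M)) (add_zero i) = r • e := (Ext.smul_eq_comp_mk₀ e r).symm

lemma mk₀_smul_comp {N M : ModuleCat.{u} R} {i : ℕ} (e : Ext N M i) (r : R) :
    (Ext.mk₀ (r • 𝟙 N)).comp e (zero_add i) = r • e := by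
  rw [Ext.mk₀_smul, Ext.smul_comp, Ext.mk₀_id_comp]

lemma smul_ext_eq_zero_of_left {N M : ModuleCat.{u} R} {i : ℕ} (r : R) (hr : ∀ x : N, r • x = 0)
    (e : Ext N M i) : r • e = 0 := by
  rw [← mk₀_smul_comp]
  have : r • 𝟙 N = 0 := by ext x; exact hr x
  rw [this, Ext.mk₀_zero, Ext.zero_comp]

lemma smul_ext_eq_zero_of_right {N M : ModuleCat.{u} R} {i : ℕ} (r : R) (hr : ∀ x : M, r • x = 0)
    (e : Ext N M i) : r • e = 0 := by
  rw [← smul_comp_mk₀]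
  have : r • 𝟙 M = 0 := by ext x; exact hr x
  rw [this, Ext.mk₀_zero, Ext.comp_zero]

/-- Modules killed by a sequence that is regular on `M` have no low-degree extensions by `M`. -/
theorem ext_subsingleton_of_isWeaklyRegular (N : ModuleCat.{u} R) (rs : List R)
    (hN : ∀ r ∈ rs, ∀ x : N, r • x = 0) (M : Type u) [AddCommGroup M] [Module R M]
    (hM : RingTheory.Sequence.IsWeaklyRegular M rs) (i : ℕ) (hi : i < rs.length) :
    Subsingleton (Ext N (ModuleCat.of R M) i) := by
  induction rs generalizing M i with
  | nil => simp at hi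
  | cons r rs ih =>
    rw [RingTheory.Sequence.isWeaklyRegular_cons_iff] at hM
    have hS := IsSMulRegular.smulShortComplex_shortExact (M := ModuleCat.of R M) hM.1
    refine subsingleton_of_forall_eq 0 fun x => ?_
    have hx : x.comp (Ext.mk₀ ((ModuleCat.of R M).smulShortComplex r).f) (add_zero i) = 0 := by
      rw [ModuleCat.smulShortComplex_f_eq_smul_id]
      exact (smul_comp_mk₀ x r).trans
        (smul_ext_eq_zero_of_left r (hN r (List.mem_cons_self ..)) x)
    rcases i with _ | i
    · have := Ext.postcomp_mk₀_injective_of_mono N ((ModuleCat.of R M).smulShortComplex r).f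
        (hf := hS.mono_f)
      exact (injective_iff_map_eq_zero _).1 this x hx
    · obtain ⟨y, rfl⟩ := Ext.covariant_sequence_exact₁ N hS x hx rfl
      have := ih (fun s hs => hN s (List.mem_cons_of_mem _ hs)) (QuotSMulTop r M) hM.2 i
        (by simpa using hi)
      have h0 : y = 0 := this.elim _ _
      rw [h0, Ext.zero_comp]
      rfl

/-- Rees' theorem: vanishing of `Ext^i (R/I, M)` for `i < n` yields an `M`-regular sequence of
length `n` in `I`. -/
theorem exists_isRegular_of_ext [IsNoetherianRing R] [IsLocalRing R] (I : Ideal R)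
    (hI : I ≤ maximalIdeal R) (n : ℕ) (M : Type u) [AddCommGroup M] [Module R M]
    [Module.Finite R M] [Nontrivial M]
    (h : ∀ i < n, Subsingleton (Ext (ModuleCat.of R (R ⧸ I)) (ModuleCat.of R M) i)) :
    ∃ rs : List R, rs.length = n ∧ (∀ r ∈ rs, r ∈ I) ∧ RingTheory.Sequence.IsRegular M rs := by
  induction n generalizing M with
  | zero => exact ⟨[], rfl, by simp, RingTheory.Sequence.IsRegular.nil R M⟩
  | succ n ih =>
    have h0 : Subsingleton ((R ⧸ I) →ₗ[R] M) :=
      (extZeroEquiv (ModuleCat.of R (R ⧸ I)) (ModuleCat.of R M)).toEquiv.subsingleton_congr.1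
        (h 0 (Nat.succ_pos n))
    -- Prime avoidance enters here: without nonzero maps `R ⧸ I → M`, the ideal `I` contains an
    -- `M`-regular element.
    obtain ⟨r, hr, hreg⟩ := IsSMulRegular.subsingleton_linearMap_iff.1 h0
    rw [Ideal.annihilator_quotient] at hr
    have := nontrivial_quotSMulTop_of_mem_maximalIdeal (L := M) (hI hr)
    have hS := IsSMulRegular.smulShortComplex_shortExact (M := ModuleCat.of R M) hreg
    obtain ⟨rs, hlen, hmem, hrs⟩ := ih (QuotSMulTop r M) (fun i hi => by
      refine subsingleton_of_forall_eq 0 fun x => ?_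
      have h1 := h (i + 1) (by omega)
      have h2 := h i (by omega)
      obtain ⟨y, rfl⟩ := Ext.covariant_sequence_exact₃ _ hS x rfl (h1.elim _ _)
      have h0 : y = 0 := h2.elim _ _
      rw [h0, Ext.zero_comp]
      rfl)
    refine ⟨r :: rs, by simp [hlen], ?_, RingTheory.Sequence.IsRegular.cons hreg hrs⟩
    intro s hs
    rcases List.mem_cons.1 hs with rfl | hs
    · exact hr
    · exact hmem s hs

end ExtLemmas

section Local

variable [IsNoetherianRing R] [IsLocalRing R]

omit [IsNoetherianRing R] in
/-- A version of Nakayama's lemma: multiplication by `y` on a nonzero finite module is not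
surjective when `y` lies in the maximal ideal. -/
lemma subsingleton_of_smul_surjective {L : Type u} [AddCommGroup L] [Module R L]
    [Module.Finite R L] {y : R} (hy : y ∈ maximalIdeal R) (h : ∀ x : L, ∃ z : L, y • z = x) :
    Subsingleton L := by
  by_contra hL
  rw [not_subsingleton_iff_nontrivial] at hL
  have := nontrivial_quotSMulTop_of_mem_maximalIdeal (L := L) hy
  obtain ⟨a, b, hab⟩ := this
  obtain ⟨a, rfl⟩ := Submodule.Quotient.mk_surjective _ a
  obtain ⟨b, rfl⟩ := Submodule.Quotient.mk_surjective _ b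
  refine hab ((Submodule.Quotient.eq _).2 ?_)
  obtain ⟨z, hz⟩ := h (a - b)
  rw [← hz]
  exact Submodule.smul_mem_pointwise_smul _ _ _ trivial

omit [IsNoetherianRing R] [IsLocalRing R] in
lemma isSMulRegular_quotient_prime {p : Ideal R} [p.IsPrime] {y : R} (hy : y ∉ p) :
    IsSMulRegular (R ⧸ p) y := by
  rw [isSMulRegular_iff_right_eq_zero_of_smul]
  intro x hx
  obtain ⟨x, rfl⟩ := Submodule.Quotient.mk_surjective _ x
  rw [← Submodule.Quotient.mk_smul, Submodule.Quotient.mk_eq_zero] at hx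
  rw [Submodule.Quotient.mk_eq_zero]
  exact (Ideal.IsPrime.mem_or_mem ‹_› hx).resolve_left hy

/-- The contravariant long exact sequence and Nakayama: if `y` is regular on `N` and
`Ext^(i+1) (N/yN, M) = 0` then `Ext^i (N, M) = 0`. -/
lemma ext_subsingleton_of_quotSMulTop (N M : Type u) [AddCommGroup N] [Module R N]
    [AddCommGroup M] [Module R M] [Module.Finite R N] [Module.Finite R M] {y : R}
    (hy : y ∈ maximalIdeal R) (hreg : IsSMulRegular N y) (i : ℕ)
    (h : Subsingleton (Ext (ModuleCat.of R (QuotSMulTop y N)) (ModuleCat.of R M) (i + 1))) :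
    Subsingleton (Ext (ModuleCat.of R N) (ModuleCat.of R M) i) := by
  have hS := IsSMulRegular.smulShortComplex_shortExact (M := ModuleCat.of R N) hreg
  refine subsingleton_of_smul_surjective (R := R) hy fun x => ?_
  obtain ⟨z, hz⟩ := Ext.contravariant_sequence_exact₁ hS (ModuleCat.of R M) x (add_comm 1 i)
    (h.elim _ _)
  refine ⟨z, ?_⟩
  rw [← hz, ModuleCat.smulShortComplex_f_eq_smul_id]
  exact (mk₀_smul_comp z y).symm

omit [IsNoetherianRing R] in
lemma maximalIdeal_ext_subsingleton_of_equiv {M : ModuleCat.{u} R} {i : ℕ}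
    (h : Subsingleton (Ext (ModuleCat.of R (ResidueField R)) M i)) {p : Ideal R}
    (hp : p = maximalIdeal R) : Subsingleton (Ext (ModuleCat.of R (R ⧸ p)) M i) := by
  subst hp; exact h

/-- Ischebeck's theorem. -/
theorem ext_subsingleton_of_supportDim (M : Type u) [AddCommGroup M] [Module R M]
    [Module.Finite R M] (d : ℕ)
    (hM : ∀ i < d, Subsingleton (Ext (ModuleCat.of R (ResidueField R)) (ModuleCat.of R M) i))
    (r : ℕ) (N : Type u) [AddCommGroup N] [Module R N] (hN : Module.Finite R N)
    (hr : Module.supportDim R N ≤ r) (i : ℕ) (hi : i + r < d) :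
    Subsingleton (Ext (ModuleCat.of R N) (ModuleCat.of R M) i) := by
  induction r using Nat.strong_induction_on generalizing N i with
  | _ r ih =>
  revert hr
  -- A prime filtration reduces `N` to `R ⧸ p`. For nonmaximal `p`, an element `y` of the maximal
  -- ideal outside `p` lowers the dimension by one, and Nakayama recovers `Ext^i` from `Ext^(i+1)`.
  induction hN using IsNoetherianRing.induction_on_isQuotientEquivQuotientPrime R with
  | subsingleton N =>
    intro _
    refine subsingleton_of_forall_eq 0 fun x => ?_
    have : 𝟙 (ModuleCat.of R N) = 0 := by ext x; exact Subsingleton.elim _ _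
    rw [← Ext.mk₀_id_comp x, this, Ext.mk₀_zero, Ext.zero_comp]
  | quotient N p f =>
    intro hr
    rw [Module.supportDim_eq_of_equiv f] at hr
    refine ext_subsingleton_of_equiv (N := ModuleCat.of R (R ⧸ p.1)) (N' := ModuleCat.of R N)
      f.symm _ i ?_
    by_cases hp : p.1 = maximalIdeal R
    · exact maximalIdeal_ext_subsingleton_of_equiv (hM i (by omega)) hp
    · obtain ⟨y, hy, hyp⟩ := SetLike.exists_of_lt
        (lt_of_le_of_ne (le_maximalIdeal p.2.ne_top) hp)
      have hp' := p.2
      have hreg := isSMulRegular_quotient_prime hyp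
      have hdim := Module.supportDim_quotSMulTop_succ_eq_supportDim hreg hy
      have hnt : Nontrivial (R ⧸ p.1) := Ideal.Quotient.nontrivial_iff.2 p.2.ne_top
      have := nontrivial_quotSMulTop_of_mem_maximalIdeal (L := R ⧸ p.1) hy
      have hne := Module.supportDim_ne_bot_of_nontrivial R (QuotSMulTop y (R ⧸ p.1))
      refine ext_subsingleton_of_quotSMulTop (R ⧸ p.1) M hy hreg i ?_
      rw [← hdim] at hr
      rcases r with _ | r
      -- For `r = 0` the prime would have to be maximal: the quotient by `y` is nonzero, so `R ⧸ p`
      -- has dimension at least one.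
      · exfalso
        have h1 : (0 : WithBot ℕ∞) ≤ Module.supportDim R (QuotSMulTop y (R ⧸ p.1)) := by
          obtain ⟨a, ha⟩ := WithBot.ne_bot_iff_exists.1 hne
          rw [← ha]
          exact WithBot.coe_le_coe.2 zero_le
        have h2 : (0 : WithBot ℕ∞) + 1 ≤ 0 := (add_le_add_left h1 1).trans (by simpa using hr)
        exact absurd h2 (by decide)
      · refine ih r (Nat.lt_succ_self r) _ inferInstance ?_ (i + 1) (by omega)
        push_cast at hr
        exact ENat.WithBot.add_le_add_one_right_iff.1 hr
  | exact N₁ N₂ N₃ f g hf hg hfg h₁ h₃ =>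
    intro hr
    let S := ShortComplex.mk (ModuleCat.ofHom f) (ModuleCat.ofHom g)
      (ModuleCat.hom_ext hfg.linearMap_comp_eq_zero)
    have hS : S.ShortExact :=
      { exact := (ShortComplex.moduleCat_exact_iff _).2 fun x hx => (hfg x).1 hx
        mono_f := (ModuleCat.mono_iff_injective _).2 hf
        epi_g := (ModuleCat.epi_iff_surjective _).2 hg }
    exact ext_subsingleton_X₂_left hS _ i
      (h₁ ((Module.supportDim_le_of_injective f hf).trans hr))
      (h₃ ((Module.supportDim_le_of_surjective g hg).trans hr))

end Local
end LocalCM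

namespace LocalCM

open Limits Opposite Abelian

variable {R : Type u} [CommRing R]

/-! ### Injective dimension and Bass' bound. -/

section InjectiveDimension

lemma mk₀_ofHom_injective {N M : ModuleCat.{u} R} {f g : N →ₗ[R] M}
    (h : Ext.mk₀ (ModuleCat.ofHom f) = Ext.mk₀ (ModuleCat.ofHom g)) : f = g := by
  rw [← extZeroEquiv_mk₀ f, h, extZeroEquiv_mk₀]

lemma mk₀_ofHom_comp {N M L : ModuleCat.{u} R} (f : N →ₗ[R] M) (g : M →ₗ[R] L) :
    (Ext.mk₀ (ModuleCat.ofHom f)).comp (Ext.mk₀ (ModuleCat.ofHom g)) (zero_add 0) =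
      Ext.mk₀ (ModuleCat.ofHom (g ∘ₗ f)) := by
  rw [Ext.mk₀_comp_mk₀]
  rfl

/-- Baer's criterion in terms of `Ext`. -/
lemma injective_of_ext_one (M : ModuleCat.{u} R)
    (h : ∀ J : Ideal R, Subsingleton (Ext (ModuleCat.of R (R ⧸ J)) M 1)) :
    Module.Injective R M := by
  refine Module.Baer.injective fun J g => ?_
  have hS := subSES_shortExact (R := R) (M := R) J
  let x : Ext (subSES (R := R) (M := R) J).X₁ M 0 := Ext.mk₀ (ModuleCat.ofHom g)
  obtain ⟨e, he⟩ := Ext.contravariant_sequence_exact₁ hS M x (rfl : 1 + 0 = 1) ((h J).elim _ _)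
  obtain ⟨f, rfl⟩ := exists_mk₀_eq e
  have h2 : f ∘ₗ Submodule.subtype J = g :=
    mk₀_ofHom_injective ((mk₀_ofHom_comp (N := ModuleCat.of R J) (M := ModuleCat.of R R)
      (Submodule.subtype J) f).symm.trans he)
  exact ⟨f, fun x hx => by rw [← h2]; rfl⟩

lemma exists_injective_embedding (M : ModuleCat.{u} R) :
    ∃ (Q : ModuleCat.{u} R) (f : M →ₗ[R] Q), Module.Injective R Q ∧ Function.Injective f := by
  obtain ⟨⟨Q, hQ, f, hf⟩⟩ := EnoughInjectives.presentation M
  exact ⟨Q, f.hom, (Module.injective_iff_injective_object R Q).2 hQ,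
    (ModuleCat.mono_iff_injective _).1 hf⟩

/-- Passing to the cokernel of an embedding into an injective lowers `n` by one, down to Baer's
criterion at `n = 1`. -/
lemma hasInjectiveDimensionLT_of_ext_quotient (n : ℕ) (hn : 1 ≤ n) (M : ModuleCat.{u} R)
    (h : ∀ J : Ideal R, Subsingleton (Ext (ModuleCat.of R (R ⧸ J)) M n)) :
    HasInjectiveDimensionLT M n := by
  induction n, hn using Nat.le_induction generalizing M with
  | base =>
    exact injective_iff_hasInjectiveDimensionLT_one.1
      ((Module.injective_iff_injective_object R M).1 (injective_of_ext_one M h))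
  | succ n hn ih =>
    obtain ⟨n, rfl⟩ : ∃ k, n = k + 1 := ⟨n - 1, by omega⟩
    obtain ⟨Q, f, hQ, hf⟩ := exists_injective_embedding M
    have hS := cokerSES_shortExact f hf
    have hQ' : Injective Q := (Module.injective_iff_injective_object R Q).1 hQ
    refine (hS.hasInjectiveDimensionLT_X₃_iff n hQ').1 (ih _ fun J => ?_)
    refine subsingleton_of_forall_eq 0 fun x => ?_
    obtain ⟨y, rfl⟩ := Ext.covariant_sequence_exact₃ _ hS x rfl ((h J).elim _ _)
    have := ext_subsingleton_of_injective (ModuleCat.of R (R ⧸ J)) Q hQ (n + 1) hn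
    have h0 : y = 0 := this.elim _ _
    rw [h0, Ext.zero_comp]

variable [IsNoetherianRing R] [IsLocalRing R]

/-- In a prime filtration, the factors with nonmaximal prime are handled by Nakayama, since
`Ext^(n+1)` vanishes for want of injective dimension. -/
lemma ext_subsingleton_of_ext_residueField (M : Type u) [AddCommGroup M] [Module R M]
    [Module.Finite R M] (n : ℕ) [HasInjectiveDimensionLT (ModuleCat.of R M) (n + 1)]
    (hk : Subsingleton (Ext (ModuleCat.of R (ResidueField R)) (ModuleCat.of R M) n))
    (N : Type u) [AddCommGroup N] [Module R N] (hN : Module.Finite R N) :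
    Subsingleton (Ext (ModuleCat.of R N) (ModuleCat.of R M) n) := by
  induction hN using IsNoetherianRing.induction_on_isQuotientEquivQuotientPrime R with
  | subsingleton N =>
    refine subsingleton_of_forall_eq 0 fun x => ?_
    have : 𝟙 (ModuleCat.of R N) = 0 := by ext x; exact Subsingleton.elim _ _
    rw [← Ext.mk₀_id_comp x, this, Ext.mk₀_zero, Ext.zero_comp]
  | quotient N p f =>
    refine ext_subsingleton_of_equiv (N := ModuleCat.of R (R ⧸ p.1)) (N' := ModuleCat.of R N)
      f.symm _ n ?_
    by_cases hp : p.1 = maximalIdeal R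
    · exact maximalIdeal_ext_subsingleton_of_equiv hk hp
    · obtain ⟨y, hy, hyp⟩ := SetLike.exists_of_lt
        (lt_of_le_of_ne (le_maximalIdeal p.2.ne_top) hp)
      have hp' := p.2
      exact ext_subsingleton_of_quotSMulTop (R ⧸ p.1) M hy (isSMulRegular_quotient_prime hyp) n
        (HasInjectiveDimensionLT.subsingleton (ModuleCat.of R M) (n + 1) (n + 1) le_rfl _)
  | exact N₁ N₂ N₃ f g hf hg hfg h₁ h₃ =>
    let S := ShortComplex.mk (ModuleCat.ofHom f) (ModuleCat.ofHom g)
      (ModuleCat.hom_ext hfg.linearMap_comp_eq_zero)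
    have hS : S.ShortExact :=
      { exact := (ShortComplex.moduleCat_exact_iff _).2 fun x hx => (hfg x).1 hx
        mono_f := (ModuleCat.mono_iff_injective _).2 hf
        epi_g := (ModuleCat.epi_iff_surjective _).2 hg }
    exact ext_subsingleton_X₂_left hS _ n h₁ h₃

/-- A finite module of finite injective dimension over a local ring of depth `d` has injective
dimension at most `d` (part of Bass' theorem). The depth condition is expressed by a regular
sequence `rs` of length `d` such that the residue field embeds into `R ⧸ rs`. -/
theorem hasInjectiveDimensionLT_of_isRegular (M : Type u) [AddCommGroup M] [Module R M]
    [Module.Finite R M] (m : ℕ) (hm : HasInjectiveDimensionLT (ModuleCat.of R M) m)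
    (rs : List R) (hrs : RingTheory.Sequence.IsRegular R rs)
    (f : ResidueField R →ₗ[R] (R ⧸ Ideal.ofList rs)) (hf : f ≠ 0) :
    HasInjectiveDimensionLT (ModuleCat.of R M) (rs.length + 1) := by
  have hinj : Function.Injective f := by
    have : IsSimpleModule R (ResidueField R) :=
      isSimpleModule_iff_isCoatom.2 (IsLocalRing.maximalIdeal.isMaximal R).out
    exact (LinearMap.injective_or_eq_zero f).resolve_right hf
  have hpd : HasProjectiveDimensionLT (ModuleCat.of R (R ⧸ Ideal.ofList rs)) (rs.length + 1) := by
    have h1 := ModuleCat.projectiveDimension_quotient_eq_length.{u} rs hrs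
    have h2 := (projectiveDimension_le_iff _ _).1 h1.le
    exact hasProjectiveDimensionLT_of_iso
      (Shrink.linearEquiv R (R ⧸ Ideal.ofList rs)).toModuleIso _
  -- `R ⧸ rs` has projective dimension `rs.length`, so its `Ext^n` vanishes. As `k` embeds in it and
  -- the cokernel has no `Ext^(n+1)`, also `Ext^n(k, M) = 0`, and the injective dimension drops.
  have step : ∀ n, rs.length + 1 ≤ n → HasInjectiveDimensionLT (ModuleCat.of R M) (n + 1) →
      HasInjectiveDimensionLT (ModuleCat.of R M) n := by
    intro n hn hM
    have hS := cokerSES_shortExact f hinj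
    have hk : Subsingleton (Ext (ModuleCat.of R (ResidueField R)) (ModuleCat.of R M) n) := by
      refine subsingleton_of_forall_eq 0 fun x => ?_
      obtain ⟨y, rfl⟩ := Ext.contravariant_sequence_exact₁ hS _ x (add_comm 1 n)
        ((HasInjectiveDimensionLT.subsingleton (ModuleCat.of R M) (n + 1) (n + 1) le_rfl _).elim
          _ _)
      have := HasProjectiveDimensionLT.subsingleton (ModuleCat.of R (R ⧸ Ideal.ofList rs))
        (rs.length + 1) n hn (ModuleCat.of R M)
      have h0 : y = 0 := this.elim _ _
      rw [h0, Ext.comp_zero]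
    exact hasInjectiveDimensionLT_of_ext_quotient n (by omega) _ fun J =>
      ext_subsingleton_of_ext_residueField M n hk _ inferInstance
  have key : ∀ j, HasInjectiveDimensionLT (ModuleCat.of R M) (rs.length + 1 + j) →
      HasInjectiveDimensionLT (ModuleCat.of R M) (rs.length + 1) := by
    intro j
    induction j with
    | zero => exact id
    | succ j ih => exact fun h => ih (step _ (by omega) h)
  exact key m (hasInjectiveDimensionLT_of_ge _ m _ (by omega))

end InjectiveDimension

/-! ### Regular sequences realizing the grade. -/

section Grade

lemma length_le_of_idealGrade {I : Ideal R} {M : Type u} [AddCommGroup M] [Module R M] {n : ℕ}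
    (h : idealGrade I M = n) {rs : List R} (hmem : ∀ r ∈ rs, r ∈ I)
    (hrs : RingTheory.Sequence.IsRegular M rs) : rs.length ≤ n := by
  have : (rs.length : ℕ∞) ≤ idealGrade I M := le_iSup₂_of_le rs ⟨hmem, hrs⟩ le_rfl
  rw [h] at this
  exact_mod_cast this

/-- A finite supremum of natural numbers is attained; `Nontrivial M` makes the empty sequence
regular, which settles grade zero. -/
lemma exists_isRegular_of_idealGrade {I : Ideal R} {M : Type u} [AddCommGroup M] [Module R M]
    [Nontrivial M] {n : ℕ} (h : idealGrade I M = n) :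
    ∃ rs : List R, rs.length = n ∧ (∀ r ∈ rs, r ∈ I) ∧ RingTheory.Sequence.IsRegular M rs := by
  by_contra! hne
  have hn : n ≠ 0 := by
    rintro rfl
    exact hne [] rfl (by simp) (RingTheory.Sequence.IsRegular.nil R M)
  have : idealGrade I M ≤ (n - 1 : ℕ) := by
    refine iSup₂_le fun rs hrs => ?_
    have h1 := length_le_of_idealGrade h hrs.1 hrs.2
    have h2 : rs.length ≠ n := fun h2 => hne rs h2 hrs.1 hrs.2
    exact_mod_cast (by omega : rs.length ≤ n - 1)
  rw [h] at this
  have : n ≤ n - 1 := by exact_mod_cast this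
  omega

/-- The residue field maps nontrivially to the quotient of `R` by a maximal regular sequence. -/
lemma exists_residueField_hom [IsNoetherianRing R] [IsLocalRing R] {n : ℕ}
    (h : idealGrade (maximalIdeal R) R = n) :
    ∃ (rs : List R) (f : ResidueField R →ₗ[R] (R ⧸ Ideal.ofList rs)), rs.length = n ∧
      (∀ r ∈ rs, r ∈ maximalIdeal R) ∧ RingTheory.Sequence.IsRegular R rs ∧ f ≠ 0 := by
  obtain ⟨rs, hlen, hmem, hrs⟩ := exists_isRegular_of_idealGrade h
  by_cases hf : Subsingleton (ResidueField R →ₗ[R] (R ⧸ Ideal.ofList rs))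
  · exfalso
    have hf' : Subsingleton ((R ⧸ maximalIdeal R) →ₗ[R] (R ⧸ Ideal.ofList rs)) := hf
    -- If no nonzero map existed, a further regular element could be appended to a sequence of
    -- maximal length.
    obtain ⟨r, hr, hreg⟩ := IsSMulRegular.subsingleton_linearMap_iff.1 hf'
    rw [Ideal.annihilator_quotient] at hr
    have hmem' : ∀ s ∈ rs ++ [r], s ∈ maximalIdeal R := by
      intro s hs
      rcases List.mem_append.1 hs with hs | hs
      · exact hmem s hs
      · rw [List.mem_singleton] at hs; rwa [hs]
    have hw : RingTheory.Sequence.IsWeaklyRegular R (rs ++ [r]) := by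
      rw [RingTheory.Sequence.isWeaklyRegular_append_iff]
      refine ⟨hrs.1, ?_⟩
      rw [RingTheory.Sequence.isWeaklyRegular_singleton_iff]
      rwa [smul_eq_mul, Ideal.mul_top]
    have := length_le_of_idealGrade h hmem'
      (RingTheory.Sequence.IsRegular.of_isWeaklyRegular_of_mem_maximalIdeal R hmem' hw)
    simp [hlen] at this
  · rw [not_subsingleton_iff_nontrivial] at hf
    obtain ⟨f, hf⟩ := exists_ne (0 : ResidueField R →ₗ[R] (R ⧸ Ideal.ofList rs))
    exact ⟨rs, f, hlen, hmem, hrs, hf⟩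

end Grade

end LocalCM

namespace LocalCM

open Limits Opposite Abelian

variable {R : Type u} [CommRing R]

/-! ### The injective hull of the residue field. -/

section InjectiveHull

lemma exists_lift_of_ext_one {S : ShortComplex (ModuleCat.{u} R)} (hS : S.ShortExact)
    {N : ModuleCat.{u} R} (h : Subsingleton (Ext N S.X₁ 1)) (g : N →ₗ[R] S.X₃) :
    ∃ l : N →ₗ[R] S.X₂, S.g.hom ∘ₗ l = g := by
  obtain ⟨y, hy⟩ := Ext.covariant_sequence_exact₃ _ hS (Ext.mk₀ (ModuleCat.ofHom g))
    (zero_add 1) (h.elim _ _)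
  obtain ⟨l, rfl⟩ := exists_mk₀_eq y
  exact ⟨l, mk₀_ofHom_injective ((mk₀_ofHom_comp l S.g.hom).symm.trans hy)⟩

lemma exists_lift_mkQ {N A B : Type u} [AddCommGroup N] [Module R N] [AddCommGroup A] [Module R A]
    [AddCommGroup B] [Module R B] (φ : A →ₗ[R] B) (hφ : Function.Injective φ)
    (h : Subsingleton (Ext (ModuleCat.of R N) (ModuleCat.of R A) 1))
    (g : N →ₗ[R] (B ⧸ LinearMap.range φ)) :
    ∃ l : N →ₗ[R] B, (LinearMap.range φ).mkQ ∘ₗ l = g :=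
  exists_lift_of_ext_one (cokerSES_shortExact φ hφ) h g

variable [IsLocalRing R] {E : Type u} [AddCommGroup E] [Module R E]

lemma injective_of_residueField {M : Type u} [AddCommGroup M] [Module R M]
    {f : ResidueField R →ₗ[R] M} (hf : f ≠ 0) : Function.Injective f := by
  have : IsSimpleModule R (ResidueField R) :=
    isSimpleModule_iff_isCoatom.2 (IsLocalRing.maximalIdeal.isMaximal R).out
  exact (LinearMap.injective_or_eq_zero f).resolve_right hf

lemma smul_residueField_eq_zero {M : Type u} [AddCommGroup M] [Module R M]
    (f : ResidueField R →ₗ[R] M) (y : ResidueField R) {a : R} (ha : a ∈ maximalIdeal R) :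
    a • f y = 0 := by
  have h : a • y = 0 := by
    obtain ⟨r, rfl⟩ := Ideal.Quotient.mk_surjective y
    have : (a • (Ideal.Quotient.mk (maximalIdeal R) r) : R ⧸ maximalIdeal R) =
      Ideal.Quotient.mk _ (a * r) := rfl
    exact this.trans (Ideal.Quotient.eq_zero_iff_mem.2 (Ideal.mul_mem_right _ _ ha))
  rw [← map_smul, h, map_zero]

lemma exists_residueField_map {M : Type u} [AddCommGroup M] [Module R M] (x : M)
    (hx : ∀ a ∈ maximalIdeal R, a • x = 0) : ∃ f : ResidueField R →ₗ[R] M, f 1 = x :=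
  exists_quotient_map (maximalIdeal R) x hx

variable (hE : IsInjectiveHull R (ResidueField R) E)

include hE

namespace IsInjectiveHull

/-- The torsion submodule is injective, hence a retract of `E`, and contains the image of `k`. The
kernel of the retraction misses that image, so essentiality makes it zero. -/
lemma isTorsion [IsNoetherianRing R] : IsTorsion (maximalIdeal R) E := by
  obtain ⟨f, hf, hess⟩ := hE.exists_essential
  obtain ⟨p, hp⟩ := (injective_torsionSub (I := maximalIdeal R) hE.injective).out
    (torsionSub (maximalIdeal R) E).subtype (Submodule.subtype_injective _) LinearMap.id
  have hker : LinearMap.ker p = ⊥ := by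
    refine hess _ (eq_bot_iff.2 ?_)
    rintro _ ⟨hx, y, rfl⟩
    have hmem : f y ∈ torsionSub (maximalIdeal R) E := by
      refine ⟨1, fun a ha => smul_residueField_eq_zero f y ?_⟩
      rwa [pow_one] at ha
    have h1 : p (f y) = ⟨f y, hmem⟩ := hp ⟨f y, hmem⟩
    rw [SetLike.mem_coe, LinearMap.mem_ker, h1] at hx
    exact congrArg Subtype.val hx
  intro x
  have h1 : x - p x ∈ LinearMap.ker p := by
    rw [LinearMap.mem_ker, map_sub, sub_eq_zero]
    exact (hp (p x)).symm
  rw [hker, Submodule.mem_bot, sub_eq_zero] at h1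
  rw [h1]
  exact (p x).2

/-- `E` is a cogenerator: the cyclic module on `x` surjects onto `k`, which embeds in `E`, and
injectivity extends this map to `M`. -/
lemma exists_map_ne_zero {M : Type u} [AddCommGroup M] [Module R M] {x : M} (hx : x ≠ 0) :
    ∃ g : M →ₗ[R] E, g x ≠ 0 := by
  obtain ⟨f, hf, -⟩ := hE.exists_essential
  have hker : LinearMap.ker (LinearMap.toSpanSingleton R M x) ≤ maximalIdeal R := by
    refine le_maximalIdeal fun h => hx ?_
    have : (1 : R) ∈ LinearMap.ker (LinearMap.toSpanSingleton R M x) := by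
      rw [h]; exact Submodule.mem_top
    simpa using this
  let f₁ : (R ⧸ LinearMap.ker (LinearMap.toSpanSingleton R M x)) →ₗ[R] M :=
    Submodule.liftQ _ (LinearMap.toSpanSingleton R M x) le_rfl
  have hf₁ : Function.Injective f₁ := by
    rw [← LinearMap.ker_eq_bot]
    exact Submodule.ker_liftQ_eq_bot _ _ _ le_rfl
  let f₂ : (R ⧸ LinearMap.ker (LinearMap.toSpanSingleton R M x)) →ₗ[R] E :=
    Submodule.liftQ _ (LinearMap.toSpanSingleton R E (f 1)) fun a ha =>
      smul_residueField_eq_zero f 1 (hker ha)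
  obtain ⟨g, hg⟩ := hE.injective.out f₁ hf₁ f₂
  refine ⟨g, ?_⟩
  have h1 := hg (Submodule.Quotient.mk 1)
  have h2 : f₁ (Submodule.Quotient.mk 1) = x := one_smul R x
  have h3 : f₂ (Submodule.Quotient.mk 1) = f 1 := one_smul R (f 1)
  rw [h2, h3] at h1
  rw [h1]
  exact fun h => one_ne_zero (hf (h.trans (map_zero f).symm))

lemma eq_zero_of_smul_eq_zero {a : R} (ha : ∀ x : E, a • x = 0) : a = 0 := by
  by_contra h
  obtain ⟨g, hg⟩ := hE.exists_map_ne_zero (M := R) h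
  refine hg ?_
  rw [← mul_one a, ← smul_eq_mul, map_smul, ha]

/-- A nonzero socle element `x` has a nonzero multiple `r • x` in the image of `k`; the maximal
ideal kills `x`, so `r` is a unit. -/
lemma exists_socle : ∃ f : ResidueField R →ₗ[R] E, Function.Injective f ∧
    ∀ x : E, (∀ a ∈ maximalIdeal R, a • x = 0) → x ∈ LinearMap.range f := by
  obtain ⟨f, hf, hess⟩ := hE.exists_essential
  refine ⟨f, hf, fun x hx => ?_⟩
  by_cases hx0 : x = 0
  · rw [hx0]; exact zero_mem _
  have h1 : Submodule.span R {x} ⊓ LinearMap.range f ≠ ⊥ := fun h => hx0 (by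
    simpa using hess _ h)
  obtain ⟨y, ⟨hy, hy'⟩, hy0⟩ := Submodule.exists_mem_ne_zero_of_ne_bot h1
  obtain ⟨r, rfl⟩ := Submodule.mem_span_singleton.1 hy
  have hr : IsUnit r := by
    by_contra hr
    exact hy0 (hx r ((mem_maximalIdeal r).2 hr))
  obtain ⟨s, hs⟩ := hr.exists_left_inv
  rw [← one_smul R x, ← hs, mul_smul]
  exact Submodule.smul_mem _ _ hy'

/-- Characterization of the injective hull of the residue field among torsion modules. -/
theorem nonempty_equiv [IsNoetherianRing R] {H : Type u} [AddCommGroup H] [Module R H]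
    (hH : IsTorsion (maximalIdeal R) H)
    (hsoc : Nonempty ((ResidueField R →ₗ[R] H) ≃ₗ[R] ResidueField R))
    (hext : Subsingleton (Ext (ModuleCat.of R (ResidueField R)) (ModuleCat.of R H) 1)) :
    Nonempty (H ≃ₗ[R] E) := by
  obtain ⟨f, hf, hfsoc⟩ := hE.exists_socle
  obtain ⟨e⟩ := hsoc
  obtain ⟨j, hj⟩ : ∃ j, e j = 1 := e.surjective 1
  have hj0 : j ≠ 0 := by
    rintro rfl
    rw [map_zero] at hj
    exact zero_ne_one hj
  have hjinj := injective_of_residueField hj0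
  have hjsoc : ∀ x : H, (∀ a ∈ maximalIdeal R, a • x = 0) → x ∈ LinearMap.range j := by
    intro x hx
    obtain ⟨g, rfl⟩ := exists_residueField_map x hx
    obtain ⟨r, hr⟩ := Ideal.Quotient.mk_surjective (e g)
    have h1 : g = r • j := e.injective (by
      rw [map_smul, hj, ← hr, Algebra.smul_def, mul_one]
      rfl)
    rw [h1]
    exact ⟨r • 1, by rw [map_smul]; rfl⟩
  obtain ⟨φ, hφ⟩ := hE.injective.out j hjinj f
  -- The kernel is torsion, and its socle lies in the range of `j`, where `φ` is injective.
  have hφinj : Function.Injective φ := by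
    rw [← LinearMap.ker_eq_bot, eq_bot_iff]
    intro x hx
    have ht : IsTorsion (maximalIdeal R) (LinearMap.ker φ) :=
      hH.of_injective _ (Submodule.subtype_injective _)
    have : (⟨x, hx⟩ : LinearMap.ker φ) = 0 := by
      refine eq_zero_of_forall_smul_eq_zero (I := maximalIdeal R) ?_ (ht ⟨x, hx⟩)
      rintro ⟨z, hz⟩ hz'
      obtain ⟨y, rfl⟩ := hjsoc z fun a ha => congrArg Subtype.val (hz' a ha)
      rw [LinearMap.mem_ker, hφ] at hz
      rw [Submodule.mk_eq_zero, (map_eq_zero_iff f hf).1 hz, map_zero]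
    exact congrArg Subtype.val this
  -- A socle element of the cokernel lifts to a socle element of `E`, because `Ext^1(k, H) = 0`; the
  -- socle of `E` is already in the range.
  have hφsurj : ∀ x, x ∈ LinearMap.range φ := by
    intro x
    rw [← Submodule.Quotient.mk_eq_zero]
    refine eq_zero_of_forall_smul_eq_zero (I := maximalIdeal R) ?_
      (hE.isTorsion.of_surjective _ (Submodule.mkQ_surjective (LinearMap.range φ))
        (Submodule.Quotient.mk x))
    intro z hz
    obtain ⟨g, rfl⟩ := exists_residueField_map z hz
    obtain ⟨h, rfl⟩ := exists_lift_mkQ φ hφinj hext g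
    obtain ⟨y, hy⟩ := hfsoc (h 1) fun a ha => smul_residueField_eq_zero h 1 ha
    change (Submodule.Quotient.mk (h 1) : E ⧸ LinearMap.range φ) = 0
    rw [Submodule.Quotient.mk_eq_zero, ← hy, ← hφ]
    exact ⟨_, rfl⟩
  exact ⟨LinearEquiv.ofBijective φ ⟨hφinj, hφsurj⟩⟩

end IsInjectiveHull

end InjectiveHull

/-! ### Properties of shift classes. -/

section Shift

/-- `ε` induces isomorphisms `Ext^i (N, M') → Ext^(i+c) (N, M)` for `I`-torsion modules `N`. -/
def IsShift (I : Ideal R) (c : ℕ) {M M' : ModuleCat.{u} R} (ε : Ext M' M c) : Prop :=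
  ∀ N : ModuleCat.{u} R, IsTorsion I N → ∀ i j (hij : i + c = j),
    Function.Bijective (fun e : Ext N M' i => e.comp ε hij)

namespace IsShift

variable {I : Ideal R} {c : ℕ} {M M' : ModuleCat.{u} R} {ε : Ext M' M c} (h : IsShift I c ε)

include h

/-- The isomorphism given by a shift. -/
noncomputable def equiv (N : ModuleCat.{u} R) (hN : IsTorsion I N) (i j : ℕ) (hij : i + c = j) :
    Ext N M' i ≃ₗ[R] Ext N M j :=
  LinearEquiv.ofBijective (ε.postcompOfLinear R N hij) (h N hN i j hij)

lemma ext_subsingleton (N : ModuleCat.{u} R) (hN : IsTorsion I N) (i j : ℕ) (hij : i + c = j)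
    (hs : Subsingleton (Ext N M j)) : Subsingleton (Ext N M' i) :=
  (h N hN i j hij).1.subsingleton

end IsShift

/-- Restricting to torsion submodules does not change homomorphisms from torsion modules. -/
def homTorsionSubEquiv {I : Ideal R} {N : Type u} [AddCommGroup N] [Module R N]
    (hN : IsTorsion I N) (M : Type u) [AddCommGroup M] [Module R M] :
    (N →ₗ[R] torsionSub I M) ≃ₗ[R] (N →ₗ[R] M) where
  toFun f := (torsionSub I M).subtype ∘ₗ f
  map_add' _ _ := rfl
  map_smul' _ _ := rfl
  invFun f := f.codRestrict _ (hN.map_mem f)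
  left_inv _ := rfl
  right_inv _ := rfl

/-- Any class comes from a map of `N` to `M ⧸ torsionSub I M`, and a torsion module has only the
zero map to a torsion-free one. -/
lemma ext_one_torsionSub_subsingleton [IsNoetherianRing R] {I : Ideal R} {N : Type u}
    [AddCommGroup N] [Module R N] (hN : IsTorsion I N) (M : Type u) [AddCommGroup M] [Module R M]
    (h : Subsingleton (Ext (ModuleCat.of R N) (ModuleCat.of R M) 1)) :
    Subsingleton (Ext (ModuleCat.of R N) (ModuleCat.of R (torsionSub I M)) 1) := by
  have hS := subSES_shortExact (torsionSub I M)
  refine subsingleton_of_forall_eq 0 fun x => ?_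
  obtain ⟨y, rfl⟩ := Ext.covariant_sequence_exact₁ _ hS x (h.elim _ _) (zero_add 1)
  obtain ⟨f, rfl⟩ := exists_mk₀_eq y
  have : f = 0 := by
    ext x
    have := hN.map_mem f x
    change f x ∈ torsionSub I (M ⧸ torsionSub I M) at this
    rwa [torsionSub_quotient_torsionSub, Submodule.mem_bot] at this
  rw [this]
  have h0 : Ext.mk₀ (ModuleCat.ofHom (0 : N →ₗ[R] (M ⧸ torsionSub I M))) = 0 := Ext.mk₀_zero _ _
  exact (congrArg (fun z => Ext.comp z hS.extClass (zero_add 1)) h0).trans (Ext.zero_comp ..)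

end Shift

end LocalCM

namespace LocalCM

open Limits Opposite Abelian

variable {R : Type u} [CommRing R]

/-! ### Vanishing of `Ext` into complete modules. -/

section Completeness

/-- For finite `M` the completion is a quotient of the completion of `R` tensored with `M`, and `R`
surjects onto its own completion. -/
lemma isPrecomplete_of_finite [IsNoetherianRing R] (I : Ideal R) [IsPrecomplete I R] (M : Type u)
    [AddCommGroup M] [Module R M] [Module.Finite R M] : IsPrecomplete I M := by
  rw [← AdicCompletion.of_surjective_iff]
  intro y
  obtain ⟨t, rfl⟩ := AdicCompletion.ofTensorProduct_surjective_of_finite I M y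
  induction t using TensorProduct.induction_on with
  | zero => exact ⟨0, by simp⟩
  | tmul r x =>
    obtain ⟨r, rfl⟩ := AdicCompletion.of_surjective I R r
    refine ⟨r • x, ?_⟩
    rw [AdicCompletion.ofTensorProduct_tmul]
    rw [map_smul]
    ext n
    rfl
  | add x y hx hy =>
    obtain ⟨a, ha⟩ := hx
    obtain ⟨b, hb⟩ := hy
    exact ⟨a + b, by rw [map_add, ha, hb, map_add]⟩

lemma injective_pi {M : ℕ → Type u} [∀ n, AddCommGroup (M n)] [∀ n, Module R (M n)]
    (h : ∀ n, Module.Injective R (M n)) : Module.Injective R (∀ n, M n) := by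
  refine ⟨fun X Y _ _ _ _ f hf g => ?_⟩
  choose l hl using fun n => (h n).out f hf (LinearMap.proj n ∘ₗ g)
  exact ⟨LinearMap.pi l, fun x => funext fun n => hl n x⟩

/-- `Ext` vanishes on products if it vanishes on the factors. -/
theorem ext_pi_subsingleton (Y : ModuleCat.{u} R) (i : ℕ) (M : ℕ → Type u)
    [∀ n, AddCommGroup (M n)] [∀ n, Module R (M n)]
    (h : ∀ n, Subsingleton (Ext Y (ModuleCat.of R (M n)) i)) :
    Subsingleton (Ext Y (ModuleCat.of R (∀ n, M n)) i) := by
  induction i generalizing M with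
  | zero =>
    refine (extZeroEquiv Y (ModuleCat.of R (∀ n, M n))).toEquiv.subsingleton_congr.2
      ⟨fun f g => ?_⟩
    have h' : ∀ n, Subsingleton (Y →ₗ[R] M n) := fun n =>
      (extZeroEquiv Y (ModuleCat.of R (M n))).toEquiv.subsingleton_congr.1 (h n)
    ext x n
    exact LinearMap.congr_fun ((h' n).elim (LinearMap.proj n ∘ₗ f) (LinearMap.proj n ∘ₗ g)) x
  | succ i ih =>
    choose Q f hQ hf using fun n => exists_injective_embedding (ModuleCat.of R (M n))
    let F : (∀ n, M n) →ₗ[R] (∀ n, Q n) := LinearMap.pi fun n => f n ∘ₗ LinearMap.proj n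
    let G : (∀ n, Q n) →ₗ[R] (∀ n, Q n ⧸ LinearMap.range (f n)) :=
      LinearMap.pi fun n => (LinearMap.range (f n)).mkQ ∘ₗ LinearMap.proj n
    have hF : Function.Injective F := fun a b hab => funext fun n => hf n (congrFun hab n)
    have hG : Function.Surjective G := fun c => by
      choose q hq using fun n => Submodule.Quotient.mk_surjective _ (c n)
      exact ⟨q, funext hq⟩
    have hFG : Function.Exact F G := by
      intro q
      constructor
      · intro hq
        have h1 : ∀ n, q n ∈ LinearMap.range (f n) := fun n =>
          (Submodule.Quotient.mk_eq_zero _).1 (congrFun hq n)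
        choose m hm using h1
        exact ⟨m, funext hm⟩
      · rintro ⟨m, rfl⟩
        exact funext fun n => (Submodule.Quotient.mk_eq_zero _).2 ⟨m n, rfl⟩
    let S := ShortComplex.mk (ModuleCat.ofHom F) (ModuleCat.ofHom G)
      (ModuleCat.hom_ext hFG.linearMap_comp_eq_zero)
    have hS : S.ShortExact :=
      { exact := (ShortComplex.moduleCat_exact_iff _).2 fun x hx => (hFG x).1 hx
        mono_f := (ModuleCat.mono_iff_injective _).2 hF
        epi_g := (ModuleCat.epi_iff_surjective _).2 hG }
    have hQ' := injective_pi hQ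
    refine subsingleton_of_forall_eq 0 fun x => ?_
    have h1 := ext_subsingleton_of_injective Y (ModuleCat.of R (∀ n, Q n)) hQ' (i + 1)
      (Nat.succ_pos i)
    obtain ⟨y, rfl⟩ := Ext.covariant_sequence_exact₁ Y hS x (h1.elim _ _) rfl
    -- For `Ext^1` the cokernels need not have vanishing `Hom`, so dimension shifting stops; instead
    -- the map `g` is lifted factor by factor.
    rcases i with _ | i
    · obtain ⟨g, rfl⟩ := exists_mk₀_eq y
      choose l hl using fun n => exists_lift_mkQ (N := Y) (f n) (hf n) (h n) (LinearMap.proj n ∘ₗ g)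
      have h2 : G ∘ₗ LinearMap.pi l = g := by
        ext x n
        exact LinearMap.congr_fun (hl n) x
      have h3 : Ext.mk₀ (ModuleCat.ofHom g) = (Ext.mk₀ (ModuleCat.ofHom (LinearMap.pi l))).comp
          (Ext.mk₀ S.g) (zero_add 0) := by
        rw [← h2]
        exact (mk₀_ofHom_comp (N := Y) (M := ModuleCat.of R (∀ n, Q n))
          (L := ModuleCat.of R (∀ n, Q n ⧸ LinearMap.range (f n))) (LinearMap.pi l) G).symm
      refine (congrArg (fun z => Ext.comp z hS.extClass (zero_add 1)) h3).trans ?_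
      rw [Ext.comp_assoc_of_second_deg_zero, hS.comp_extClass, Ext.comp_zero]
    · have := ih (fun n => Q n ⧸ LinearMap.range (f n)) fun n => by
        have hSn := cokerSES_shortExact (f n) (hf n)
        refine subsingleton_of_forall_eq 0 fun x => ?_
        obtain ⟨y, rfl⟩ := Ext.covariant_sequence_exact₃ Y hSn x rfl ((h n).elim _ _)
        have h0 : y = 0 := (ext_subsingleton_of_injective Y (Q n) (hQ n) (i + 1)
          (Nat.succ_pos i)).elim _ _
        rw [h0, Ext.zero_comp]
      have h0 : y = 0 := this.elim _ _
      rw [h0, Ext.zero_comp]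

/-- On `Ext`, multiplication by `x` is invertible through `Y` and zero through `M`. -/
lemma ext_subsingleton_of_bijective_of_annihilated (Y M : ModuleCat.{u} R) (x : R)
    (hY : Function.Bijective (fun y : Y => x • y)) (hM : ∀ m : M, x • m = 0) (i : ℕ) :
    Subsingleton (Ext Y M i) := by
  let e : Y ≃ₗ[R] Y := LinearEquiv.ofBijective (LinearMap.lsmul R Y x) hY
  refine subsingleton_of_forall_eq 0 fun z => ?_
  have h1 : (Ext.mk₀ e.toModuleIso.inv).comp ((Ext.mk₀ e.toModuleIso.hom).comp z (zero_add i))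
      (zero_add i) = z := by
    rw [Ext.mk₀_comp_mk₀_assoc, Iso.inv_hom_id, Ext.mk₀_id_comp]
  have h2 : e.toModuleIso.hom = x • 𝟙 Y := rfl
  rw [h2, mk₀_smul_comp, smul_ext_eq_zero_of_right x hM, Ext.comp_zero] at h1
  exact h1.symm

lemma bijective_pow_smul {Y : Type u} [AddCommGroup Y] [Module R Y] {x : R}
    (hY : Function.Bijective (fun y : Y => x • y)) (n : ℕ) :
    Function.Bijective (fun y : Y => x ^ n • y) := by
  induction n with
  | zero => simp only [pow_zero, one_smul]; exact Function.bijective_id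
  | succ n ih =>
    have : (fun y : Y => x ^ (n + 1) • y) = (fun y : Y => x ^ n • y) ∘ (fun y : Y => x • y) := by
      ext y; simp [pow_succ, mul_smul]
    rw [this]
    exact ih.comp hY

/-- If some element of `I` acts bijectively on `Y` and `M` is `I`-adically complete then all
`Ext^i (Y, M)` vanish. -/
theorem ext_subsingleton_of_bijective (I : Ideal R) (M : Type u) [AddCommGroup M] [Module R M]
    [IsAdicComplete I M] {x : R} (hx : x ∈ I) (Y : ModuleCat.{u} R)
    (hY : Function.Bijective (fun y : Y => x • y)) (i : ℕ) :
    Subsingleton (Ext Y (ModuleCat.of R M) i) := by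
  let P : ℕ → Type u := fun n => M ⧸ (I ^ n • ⊤ : Submodule R M)
  have hle : ∀ n, (I ^ (n + 1) • ⊤ : Submodule R M) ≤ I ^ n • ⊤ := fun n =>
    Submodule.smul_mono_left (Ideal.pow_le_pow_right n.le_succ)
  let π : ∀ n, P (n + 1) →ₗ[R] P n := fun n => Submodule.mapQ _ _ LinearMap.id (hle n)
  let F : M →ₗ[R] (∀ n, P n) := LinearMap.pi fun n => Submodule.mkQ _
  let G : (∀ n, P n) →ₗ[R] (∀ n, P n) :=
    LinearMap.pi fun n => LinearMap.proj n - π n ∘ₗ LinearMap.proj (n + 1)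
  have hF : Function.Injective F := by
    rw [← LinearMap.ker_eq_bot, LinearMap.ker_eq_bot']
    intro m hm
    refine IsHausdorff.haus (I := I) inferInstance m fun n => ?_
    rw [SModEq.zero]
    exact (Submodule.Quotient.mk_eq_zero _).1 (congrFun hm n)
  have hG : Function.Surjective G := fun c => by
    choose q hq using fun n => Submodule.Quotient.mk_surjective _ (c n)
    -- Negative partial sums solve `b n - b (n + 1) = q n`.
    refine ⟨fun n => Submodule.Quotient.mk (-∑ j ∈ Finset.range n, q j), funext fun n => ?_⟩
    change Submodule.Quotient.mk _ - Submodule.Quotient.mk _ = c n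
    rw [← hq, ← Submodule.Quotient.mk_sub, Finset.sum_range_succ]
    congr 1
    simp
  have hFG : Function.Exact F G := by
    intro a
    constructor
    · intro ha
      choose q hq using fun n => Submodule.Quotient.mk_surjective _ (a n)
      have h1 : ∀ n, q n ≡ q (n + 1) [SMOD (I ^ n • ⊤ : Submodule R M)] := by
        intro n
        have := congrFun ha n
        change a n - π n (a (n + 1)) = 0 at this
        rw [← hq, ← hq, sub_eq_zero] at this
        exact this
      have h2 : ∀ {m n : ℕ}, m ≤ n → q m ≡ q n [SMOD (I ^ m • ⊤ : Submodule R M)] := by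
        intro m n hmn
        induction n, hmn using Nat.le_induction with
        | base => rfl
        | succ n hmn ih =>
          exact ih.trans ((h1 n).mono (Submodule.smul_mono_left (Ideal.pow_le_pow_right hmn)))
      obtain ⟨L, hL⟩ := IsPrecomplete.prec (I := I) (M := M) inferInstance h2
      exact ⟨L, funext fun n => Eq.trans (hL n).symm (hq n)⟩
    · rintro ⟨m, rfl⟩
      exact funext fun n => sub_self (Submodule.Quotient.mk m : P n)
  let S := ShortComplex.mk (ModuleCat.ofHom F) (ModuleCat.ofHom G)
    (ModuleCat.hom_ext hFG.linearMap_comp_eq_zero)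
  have hS : S.ShortExact :=
    { exact := (ShortComplex.moduleCat_exact_iff _).2 fun x hx => (hFG x).1 hx
      mono_f := (ModuleCat.mono_iff_injective _).2 hF
      epi_g := (ModuleCat.epi_iff_surjective _).2 hG }
  have hP : ∀ i, Subsingleton (Ext Y (ModuleCat.of R (∀ n, P n)) i) := fun i =>
    ext_pi_subsingleton Y i P fun n =>
      ext_subsingleton_of_bijective_of_annihilated Y _ (x ^ n) (bijective_pow_smul hY n)
        (fun m => by
          obtain ⟨m, rfl⟩ := Submodule.Quotient.mk_surjective _ m
          rw [← Submodule.Quotient.mk_smul, Submodule.Quotient.mk_eq_zero]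
          exact Submodule.smul_mem_smul (Ideal.pow_mem_pow hx n) trivial) i
  rcases i with _ | i
  · have hinj := Ext.postcomp_mk₀_injective_of_mono Y S.f (hf := hS.mono_f)
    have := hP 0
    exact hinj.subsingleton
  · refine subsingleton_of_forall_eq 0 fun x => ?_
    obtain ⟨y, rfl⟩ := Ext.covariant_sequence_exact₁ Y hS x ((hP (i + 1)).elim _ _) rfl
    have h0 : y = 0 := (hP i).elim _ _
    rw [h0, Ext.zero_comp]

end Completeness

/-! ### Injective modules modulo torsion. -/

section InjectiveQuotient

variable [IsNoetherianRing R]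

/-- Multiplication by `x` is injective as no torsion is left; extending the identity along it, by
injectivity of the quotient, gives surjectivity. -/
lemma bijective_smul_quotient_torsionSub (x : R) {Q : Type u} [AddCommGroup Q] [Module R Q]
    (hQ : Module.Injective R Q) :
    Function.Bijective (fun y : Q ⧸ torsionSub (Ideal.span {x}) Q => x • y) := by
  have hW := injective_quotient_torsionSub (Ideal.span {x}) hQ
  let φ := LinearMap.lsmul R (Q ⧸ torsionSub (Ideal.span {x}) Q) x
  have hφ : Function.Injective φ := by
    rw [← LinearMap.ker_eq_bot, LinearMap.ker_eq_bot']
    intro y hy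
    have : y ∈ torsionSub (Ideal.span {x}) (Q ⧸ torsionSub (Ideal.span {x}) Q) := by
      refine ⟨1, fun a ha => ?_⟩
      rw [pow_one] at ha
      obtain ⟨b, rfl⟩ := Ideal.mem_span_singleton'.1 ha
      rw [mul_smul]
      exact (congrArg (b • ·) hy).trans (smul_zero b)
    rwa [torsionSub_quotient_torsionSub, Submodule.mem_bot] at this
  obtain ⟨h, hh⟩ := hW.out φ hφ LinearMap.id
  refine ⟨hφ, fun y => ⟨h y, ?_⟩⟩
  have := hh y
  change h (x • y) = y at this
  rwa [map_smul] at this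

/-- If `Q` is injective, `M` is `I`-adically complete and `J ≤ I`, then all
`Ext^i (Q ⧸ Γ_J Q, M)` vanish. -/
theorem ext_quotient_torsionSub_subsingleton (I : Ideal R) (M : Type u) [AddCommGroup M]
    [Module R M] [IsAdicComplete I M] (J : Ideal R) (hJ : J ≤ I) (i : ℕ) (Q : Type u)
    [AddCommGroup Q] [Module R Q] (hQ : Module.Injective R Q) :
    Subsingleton (Ext (ModuleCat.of R (Q ⧸ torsionSub J Q)) (ModuleCat.of R M) i) := by
  revert hJ Q
  refine Submodule.fg_induction (R := R) (M := R) (motive := fun J _ => J ≤ I →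
    ∀ (Q : Type u) [AddCommGroup Q]
    [Module R Q], Module.Injective R Q → Subsingleton (Ext (ModuleCat.of R
      (Q ⧸ torsionSub (R := R) J Q)) (ModuleCat.of R M) i)) ?_ ?_ J (IsNoetherian.noetherian J)
  · intro x hx Q _ _ hQ
    exact ext_subsingleton_of_bijective I M (hx (Submodule.mem_span_singleton_self x)) _
      (bijective_smul_quotient_torsionSub x hQ) i
  · intro J₁ J₂ _ _ h₁ h₂ hJ Q _ _ hQ
    have hmono : ∀ {K L : Ideal R}, K ≤ L → torsionSub L Q ≤ torsionSub K Q :=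
      fun hKL x ⟨n, hn⟩ => ⟨n, fun a ha => hn a (Ideal.pow_right_mono hKL n ha)⟩
    -- Taking `J₁ ⊔ J₂`-torsion amounts to taking `J₂`-torsion inside `J₁`-torsion. The induction
    -- hypothesis for `J₂` applies to `torsionSub J₁ Q` since that module is again injective.
    let f : (torsionSub J₁ Q ⧸ torsionSub J₂ (torsionSub J₁ Q)) →ₗ[R]
        (Q ⧸ torsionSub (J₁ ⊔ J₂) Q) :=
      Submodule.mapQ _ _ (torsionSub J₁ Q).subtype (by
        rintro ⟨x, m, hm⟩ ⟨n, hn⟩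
        refine ⟨m + n, fun a ha => ?_⟩
        obtain ⟨b, hb, c, hc, rfl⟩ :=
          Submodule.mem_sup.1 (Ideal.sup_pow_add_le_pow_sup_pow ha)
        rw [Submodule.subtype_apply, add_smul, hm b hb, zero_add]
        exact congrArg Subtype.val (hn c hc))
    let g : (Q ⧸ torsionSub (J₁ ⊔ J₂) Q) →ₗ[R] (Q ⧸ torsionSub J₁ Q) :=
      Submodule.mapQ _ _ LinearMap.id (hmono le_sup_left)
    have hf : Function.Injective f := by
      rw [← LinearMap.ker_eq_bot, LinearMap.ker_eq_bot']
      intro x hx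
      obtain ⟨x, rfl⟩ := Submodule.Quotient.mk_surjective _ x
      obtain ⟨n, hn⟩ := hmono (le_sup_right : J₂ ≤ J₁ ⊔ J₂)
        ((Submodule.Quotient.mk_eq_zero _).1 hx)
      exact (Submodule.Quotient.mk_eq_zero _).2 ⟨n, fun a ha => Subtype.ext (hn a ha)⟩
    have hg : Function.Surjective g := fun x => by
      obtain ⟨x, rfl⟩ := Submodule.Quotient.mk_surjective _ x
      exact ⟨Submodule.Quotient.mk x, rfl⟩
    have hfg : Function.Exact f g := by
      intro x
      obtain ⟨x, rfl⟩ := Submodule.Quotient.mk_surjective _ x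
      constructor
      · intro hx
        exact ⟨Submodule.Quotient.mk ⟨x, (Submodule.Quotient.mk_eq_zero _).1 hx⟩, rfl⟩
      · rintro ⟨y, hy⟩
        obtain ⟨y, rfl⟩ := Submodule.Quotient.mk_surjective _ y
        rw [← hy]
        exact (Submodule.Quotient.mk_eq_zero _).2 y.2
    let S := ShortComplex.mk (ModuleCat.ofHom f) (ModuleCat.ofHom g)
      (ModuleCat.hom_ext hfg.linearMap_comp_eq_zero)
    have hS : S.ShortExact :=
      { exact := (ShortComplex.moduleCat_exact_iff _).2 fun x hx => (hfg x).1 hx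
        mono_f := (ModuleCat.mono_iff_injective _).2 hf
        epi_g := (ModuleCat.epi_iff_surjective _).2 hg }
    exact ext_subsingleton_X₂_left hS _ i
      (h₂ (le_sup_right.trans hJ) _ (injective_torsionSub hQ))
      (h₁ (le_sup_left.trans hJ) Q hQ)

end InjectiveQuotient
end LocalCM

namespace LocalCM

open Limits Opposite Abelian

variable {R : Type u} [CommRing R]

/-! ### Dualizing classes and top-degree duality. -/

section TorsionMap

variable (I : Ideal R) {M N : Type u} [AddCommGroup M] [Module R M] [AddCommGroup N] [Module R N]

/-- The map induced on torsion submodules. -/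
def torsionMap (g : M →ₗ[R] N) : torsionSub I M →ₗ[R] torsionSub I N :=
  (g ∘ₗ (torsionSub I M).subtype).codRestrict _ (isTorsion_torsionSub.map_mem _)

/-- Composition with a fixed extension, as a linear map on homomorphisms. -/
noncomputable def homCompExt {E M : ModuleCat.{u} R} {d : ℕ} (τ : Ext E M d) (N : ModuleCat.{u} R) :
    (N →ₗ[R] E) →ₗ[R] Ext N M d :=
  τ.postcompOfLinear R N (zero_add d) ∘ₗ (extZeroEquiv N E).symm.toLinearMap

lemma homCompExt_apply {E M : ModuleCat.{u} R} {d : ℕ} (τ : Ext E M d) {N : ModuleCat.{u} R}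
    (f : N →ₗ[R] E) :
    homCompExt τ N f = (Ext.mk₀ (ModuleCat.ofHom f)).comp τ (zero_add d) := rfl

lemma homCompExt_comp {E M : ModuleCat.{u} R} {d : ℕ} (τ : Ext E M d) {N N' : ModuleCat.{u} R}
    (f : N →ₗ[R] E) (g : N' →ₗ[R] N) :
    homCompExt τ N' (f ∘ₗ g) =
      (Ext.mk₀ (ModuleCat.ofHom g)).comp (homCompExt τ N f) (zero_add d) := by
  rw [homCompExt_apply, homCompExt_apply, ← mk₀_ofHom_comp,
    Ext.comp_assoc _ _ _ _ _ (zero_add d)]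

lemma IsShift.homCompExt_bijective {I : Ideal R} {c : ℕ} {M M' : ModuleCat.{u} R} {ε : Ext M' M c}
    (h : IsShift I c ε) (N : ModuleCat.{u} R) (hN : IsTorsion I N) :
    Function.Bijective (homCompExt ε N) :=
  (h N hN 0 c (zero_add c)).comp (extZeroEquiv N M').symm.bijective

end TorsionMap

section Duality

variable [IsNoetherianRing R] [IsLocalRing R]

/-- On torsion modules the functor `Ext^d (-, M)` is represented by the injective hull of the
residue field, via the class `τ`. -/
def IsDualizingClass (I : Ideal R) {E M : ModuleCat.{u} R} {d : ℕ} (τ : Ext E M d) : Prop :=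
  ∀ N : ModuleCat.{u} R, IsTorsion I N →
    Function.Bijective (homCompExt τ N) ∧ ∀ i < d, Subsingleton (Ext N M i)

/-- The torsion of the shifted module `M'` has one-dimensional socle and no `Ext^1` from `k`, so it
is isomorphic to `E`; the class `τ` is the pullback of `ε` along `E → M'`. -/
theorem exists_isDualizingClass {E : Type u} [AddCommGroup E] [Module R E]
    (hE : IsInjectiveHull R (ResidueField R) E) (M : ModuleCat.{u} R) (d : ℕ)
    (hlow : ∀ i < d, Subsingleton (Ext (ModuleCat.of R (ResidueField R)) M i))
    (htype : Nonempty (Ext (ModuleCat.of R (ResidueField R)) M d ≃ₗ[R] ResidueField R))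
    (hsucc : Subsingleton (Ext (ModuleCat.of R (ResidueField R)) M (d + 1))) :
    ∃ τ : Ext (ModuleCat.of R E) M d, IsDualizingClass (maximalIdeal R) τ := by
  obtain ⟨M', ε, hε⟩ := exists_shift (maximalIdeal R) d M hlow
  have hshift : IsShift (maximalIdeal R) d ε := fun N hN => (hε N hN).2
  have hk : IsTorsion (maximalIdeal R) (ResidueField R) := isTorsion_quotient (maximalIdeal R)
  obtain ⟨e⟩ := htype
  obtain ⟨η⟩ := hE.nonempty_equiv (H := torsionSub (maximalIdeal R) M') isTorsion_torsionSub
    ⟨homTorsionSubEquiv hk M' ≪≫ₗ (extZeroEquiv (ModuleCat.of R (ResidueField R)) M').symm ≪≫ₗ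
      hshift.equiv _ hk 0 d (zero_add d) ≪≫ₗ e⟩
    (ext_one_torsionSub_subsingleton hk M'
      (hshift.ext_subsingleton _ hk 1 (d + 1) (add_comm 1 d) hsucc))
  let g : E →ₗ[R] M' := (torsionSub (maximalIdeal R) M').subtype ∘ₗ η.symm.toLinearMap
  refine ⟨homCompExt ε (ModuleCat.of R E) g, fun N hN => ⟨?_, (hε N hN).1⟩⟩
  have h2 : Function.Bijective fun f : N →ₗ[R] E =>
      (η.symm.toLinearMap ∘ₗ f : N →ₗ[R] torsionSub (maximalIdeal R) M') :=
    ⟨fun f f' h => LinearMap.ext fun x => η.symm.injective (LinearMap.congr_fun h x),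
      fun f => ⟨η.toLinearMap ∘ₗ f, LinearMap.ext fun x => η.symm_apply_apply (f x)⟩⟩
  have h3 := (hshift.homCompExt_bijective N hN).comp ((homTorsionSubEquiv hN M').bijective.comp h2)
  have h4 : (homCompExt (homCompExt ε (ModuleCat.of R E) g) N : (N →ₗ[R] E) → Ext N M d) =
      homCompExt ε N ∘ homTorsionSubEquiv hN M' ∘ fun f : N →ₗ[R] E =>
        (η.symm.toLinearMap ∘ₗ f : N →ₗ[R] torsionSub (maximalIdeal R) M') :=
    funext fun f => (homCompExt_comp ε (N := ModuleCat.of R E) g f).symm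
  rw [h4]
  exact h3

variable {I : Ideal R} {E M : ModuleCat.{u} R} {d : ℕ} {τ : Ext E M d}

namespace IsDualizingClass

variable (hτ : IsDualizingClass I τ)

include hτ

/-- The isomorphism `Hom (N, E) ≃ Ext^d (N, M)` for torsion modules `N`. -/
noncomputable def equiv (N : ModuleCat.{u} R) (hN : IsTorsion I N) :
    (N →ₗ[R] E) ≃ₗ[R] Ext N M d :=
  LinearEquiv.ofBijective _ (hτ N hN).1

variable [IsAdicComplete I M] [HasInjectiveDimensionLT M (d + 1)]

omit [IsLocalRing R] [HasInjectiveDimensionLT M (d + 1)] in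
-- The torsion part has no `Ext` below degree `d`, and the quotient has none at all by completeness.
lemma ext_injective_subsingleton (Q : ModuleCat.{u} R) (hQ : Module.Injective R Q) (i : ℕ)
    (hi : i < d) : Subsingleton (Ext Q M i) :=
  ext_subsingleton_X₂_left (subSES_shortExact (torsionSub I Q)) M i
    ((hτ (ModuleCat.of R (torsionSub I Q)) isTorsion_torsionSub).2 i hi)
    (ext_quotient_torsionSub_subsingleton I M I le_rfl i Q hQ)

omit [IsLocalRing R] hτ in
-- As `Ext^(d+1)` vanishes, `Ext^d(-, M)` turns injections into surjections, so a torsion-free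
-- injective overmodule decides the matter.
lemma ext_top_subsingleton (N : ModuleCat.{u} R) (hN : torsionSub I N = ⊥) :
    Subsingleton (Ext N M d) := by
  obtain ⟨Q, f, hQ, hf, hΓ⟩ := exists_injective_torsionSub_eq_bot I N hN
  have hS := cokerSES_shortExact f hf
  have h1 : Subsingleton (Ext Q M d) :=
    ext_subsingleton_of_equiv (N := ModuleCat.of R (Q ⧸ torsionSub I Q)) (N' := Q)
      (Submodule.quotEquivOfEqBot _ hΓ) M d
      (ext_quotient_torsionSub_subsingleton I M I le_rfl d Q hQ)
  refine subsingleton_of_forall_eq 0 fun x => ?_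
  obtain ⟨y, rfl⟩ := Ext.contravariant_sequence_exact₁ hS M x (add_comm 1 d)
    ((HasInjectiveDimensionLT.subsingleton M (d + 1) (d + 1) le_rfl _).elim _ _)
  have h0 : y = 0 := h1.elim _ _
  rw [h0, Ext.comp_zero]

omit [IsLocalRing R] hτ in
lemma bijective_restrict (N : ModuleCat.{u} R) :
    Function.Bijective ((Ext.mk₀ (ModuleCat.ofHom (torsionSub I N).subtype)).precompOfLinear R M
      (zero_add d)) := by
  have hS := subSES_shortExact (torsionSub I N)
  constructor
  · rw [← LinearMap.ker_eq_bot, LinearMap.ker_eq_bot']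
    intro x hx
    obtain ⟨y, rfl⟩ := Ext.contravariant_sequence_exact₂ hS M x hx
    have h0 : y = 0 := (ext_top_subsingleton (I := I) (M := M) (d := d)
      (ModuleCat.of R (N ⧸ torsionSub I N)) torsionSub_quotient_torsionSub).elim _ _
    rw [h0, Ext.comp_zero]
  · intro x
    exact Ext.contravariant_sequence_exact₁ hS M x (add_comm 1 d)
      ((HasInjectiveDimensionLT.subsingleton M (d + 1) (d + 1) le_rfl _).elim _ _)

/-- The isomorphism `Ext^d (N, M) ≃ Hom (Γ_I N, E)`. -/
noncomputable def topEquiv (N : ModuleCat.{u} R) : Ext N M d ≃ₗ[R] (torsionSub I N →ₗ[R] E) :=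
  LinearEquiv.ofBijective _ (bijective_restrict (I := I) (M := M) (d := d) N) ≪≫ₗ
    (hτ.equiv (ModuleCat.of R (torsionSub I N)) isTorsion_torsionSub).symm

omit [IsLocalRing R] in
lemma homCompExt_topEquiv (N : ModuleCat.{u} R) (x : Ext N M d) :
    homCompExt τ (ModuleCat.of R (torsionSub I N)) (hτ.topEquiv N x) =
      (Ext.mk₀ (ModuleCat.ofHom (torsionSub I N).subtype)).comp x (zero_add d) :=
  (hτ.equiv (ModuleCat.of R (torsionSub I N)) isTorsion_torsionSub).apply_symm_apply _

omit [IsLocalRing R] in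
lemma topEquiv_naturality {N N' : ModuleCat.{u} R} (g : N' →ₗ[R] N) (x : Ext N M d) :
    hτ.topEquiv N' ((Ext.mk₀ (ModuleCat.ofHom g)).comp x (zero_add d)) =
      hτ.topEquiv N x ∘ₗ torsionMap I g := by
  refine (hτ (ModuleCat.of R (torsionSub I N')) isTorsion_torsionSub).1.1 ?_
  rw [homCompExt_topEquiv, homCompExt_comp (N := ModuleCat.of R (torsionSub I N)),
    homCompExt_topEquiv]
  rw [Ext.mk₀_comp_mk₀_assoc, Ext.mk₀_comp_mk₀_assoc]
  rfl

end IsDualizingClass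

end Duality

end LocalCM

namespace LocalCM

open Limits Opposite Abelian

variable {R : Type u} [CommRing R]

/-! ### Connecting maps and local duality. -/

section Connecting

variable {I : Ideal R} {S : ShortComplex (ModuleCat.{u} R)}

lemma extPowMap_comp {i n j : ℕ} {M M' : ModuleCat.{u} R} (ε : Ext M M' n) (hij : i + n = j)
    {k l : ℕ} (h : k ≤ l) (e : Ext (ModuleCat.of R (R ⧸ I ^ k)) M i) :
    (extPowMap I i M h e).comp ε hij = extPowMap I j M' h (e.comp ε hij) :=
  Ext.comp_assoc _ _ _ (zero_add i) hij (by omega)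

lemma mk₀_comp_extClass_eq_zero (hS : S.ShortExact) {N : ModuleCat.{u} R} (f : N →ₗ[R] S.X₂) :
    (Ext.mk₀ (ModuleCat.ofHom (S.g.hom ∘ₗ f))).comp hS.extClass (zero_add 1) = 0 := by
  rw [← mk₀_ofHom_comp, Ext.comp_assoc_of_second_deg_zero]
  exact (congrArg (fun z => Ext.comp _ z (zero_add 1)) hS.comp_extClass).trans (Ext.comp_zero ..)

/-- In degrees where the middle term contributes nothing, the connecting homomorphism is an
isomorphism of local cohomology modules. -/
lemma IsLocalH.nonempty_equiv_of_shortExact (hS : S.ShortExact) (j : ℕ)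
    (hj : ∀ N : ModuleCat.{u} R, Subsingleton (Ext N S.X₂ j))
    (hj' : ∀ N : ModuleCat.{u} R, Subsingleton (Ext N S.X₂ (j + 1)))
    {L L' : Type u} [AddCommGroup L] [Module R L] [AddCommGroup L'] [Module R L']
    {ι : ∀ k : ℕ, Ext (ModuleCat.of R (R ⧸ I ^ k)) S.X₃ j →ₗ[R] L}
    {ι' : ∀ k : ℕ, Ext (ModuleCat.of R (R ⧸ I ^ k)) S.X₁ (j + 1) →ₗ[R] L'}
    (hL : IsLocalH I j S.X₃ ι) (hL' : IsLocalH I (j + 1) S.X₁ ι') : Nonempty (L ≃ₗ[R] L') := by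
  refine hL.nonempty_equiv hL' (fun k => hS.extClass.postcompOfLinear R _ rfl) (fun k => ⟨?_, ?_⟩)
    (fun h e => extPowMap_comp hS.extClass rfl h e)
  · rw [← LinearMap.ker_eq_bot, LinearMap.ker_eq_bot']
    intro x hx
    obtain ⟨y, rfl⟩ := Ext.covariant_sequence_exact₃ _ hS x rfl hx
    rw [(hj _).elim y 0, Ext.zero_comp]
  · intro x
    exact Ext.covariant_sequence_exact₁ _ hS x ((hj' _).elim _ _) rfl

/-- The first local cohomology module of `X₁` is the cokernel of `Γ_I X₂ → Γ_I X₃`. -/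
lemma IsLocalH.exists_connecting (hS : S.ShortExact)
    (h1 : ∀ N : ModuleCat.{u} R, Subsingleton (Ext N S.X₂ 1))
    {L : Type u} [AddCommGroup L] [Module R L]
    {ι : ∀ k : ℕ, Ext (ModuleCat.of R (R ⧸ I ^ k)) S.X₁ 1 →ₗ[R] L} (hL : IsLocalH I 1 S.X₁ ι) :
    ∃ δ : torsionSub I S.X₃ →ₗ[R] L, Function.Surjective δ ∧
      Function.Exact (torsionMap I S.g.hom) δ := by
  obtain ⟨ι₀, h₀, hι₀⟩ := isLocalH_zero I S.X₃
  obtain ⟨δ, hδ⟩ := h₀.exists_desc (fun k => ι k ∘ₗ hS.extClass.postcompOfLinear R _ (zero_add 1))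
    (by
      intro k l h e
      change ι l ((extPowMap I 0 S.X₃ h e).comp hS.extClass (zero_add 1)) = ι k _
      rw [extPowMap_comp, hL.compat]
      rfl)
  have hδ' : ∀ k (e : Ext (ModuleCat.of R (R ⧸ I ^ k)) S.X₃ 0),
    δ (ι₀ k e) = ι k (e.comp hS.extClass (zero_add 1)) := hδ
  refine ⟨δ, ?_, ?_⟩
  · intro x
    obtain ⟨k, e, rfl⟩ := hL.surj x
    obtain ⟨y, rfl⟩ := Ext.covariant_sequence_exact₁ _ hS e ((h1 _).elim _ _) (zero_add 1)
    exact ⟨ι₀ k y, hδ' k y⟩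
  · intro y
    constructor
    · intro hy
      obtain ⟨k, e, rfl⟩ := h₀.surj y
      rw [hδ'] at hy
      obtain ⟨l, h, hl⟩ := hL.ker _ _ hy
      rw [← extPowMap_comp] at hl
      obtain ⟨z, hz⟩ := Ext.covariant_sequence_exact₃ _ hS _ (zero_add 1) hl
      obtain ⟨f, rfl⟩ := exists_mk₀_eq z
      refine ⟨⟨f (Submodule.Quotient.mk 1), (isTorsion_quotient_pow I l).map_mem f _⟩, ?_⟩
      have h2 : extPowMap I 0 S.X₃ h e = Ext.mk₀ (ModuleCat.ofHom (S.g.hom ∘ₗ f)) :=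
        hz.symm.trans (mk₀_ofHom_comp f S.g.hom)
      refine Subtype.ext ?_
      rw [← h₀.compat h, h2, hι₀]
      rfl
    · rintro ⟨⟨q, k, hq⟩, rfl⟩
      obtain ⟨f, rfl⟩ := exists_quotient_map _ q hq
      have h2 : torsionMap I S.g.hom ⟨f (Submodule.Quotient.mk 1), k, hq⟩ =
          ι₀ k (Ext.mk₀ (ModuleCat.ofHom (S.g.hom ∘ₗ f))) := Subtype.ext (hι₀ k (S.g.hom ∘ₗ f)).symm
      rw [h2, hδ']
      exact (congrArg (ι k) (mk₀_comp_extClass_eq_zero hS (N := ModuleCat.of R (R ⧸ I ^ k)) f)).trans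
        (map_zero _)

lemma IsLocalH.nonempty_equiv_torsionSub {N : ModuleCat.{u} R} {L : Type u} [AddCommGroup L]
    [Module R L] {ι : ∀ k : ℕ, Ext (ModuleCat.of R (R ⧸ I ^ k)) N 0 →ₗ[R] L}
    (hL : IsLocalH I 0 N ι) : Nonempty (L ≃ₗ[R] torsionSub I N) := by
  obtain ⟨ι₀, h₀, -⟩ := isLocalH_zero I N
  exact hL.nonempty_equiv h₀ (fun _ => LinearMap.id) (fun _ => Function.bijective_id)
    (fun _ _ => rfl)

end Connecting

section Duality

variable [IsNoetherianRing R] {I : Ideal R} {E M : ModuleCat.{u} R} {d : ℕ} {τ : Ext E M d}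

omit [IsNoetherianRing R] in
/-- Two injective linear maps with the same range have isomorphic sources. -/
lemma nonempty_equiv_of_range_eq {A B C : Type u} [AddCommGroup A] [Module R A] [AddCommGroup B]
    [Module R B] [AddCommGroup C] [Module R C] (f : A →ₗ[R] C) (g : B →ₗ[R] C)
    (hf : Function.Injective f) (hg : Function.Injective g)
    (h : LinearMap.range f = LinearMap.range g) : Nonempty (A ≃ₗ[R] B) :=
  ⟨LinearEquiv.ofInjective f hf ≪≫ₗ LinearEquiv.ofEq _ _ h ≪≫ₗ
    (LinearEquiv.ofInjective g hg).symm⟩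

/-- Grothendieck's local duality. -/
theorem IsDualizingClass.nonempty_equiv (hτ : IsDualizingClass I τ) [IsAdicComplete I M]
    [HasInjectiveDimensionLT M (d + 1)] (j i : ℕ) (hij : i + j = d) (N : ModuleCat.{u} R)
    {L : Type u} [AddCommGroup L] [Module R L]
    {ι : ∀ k : ℕ, Ext (ModuleCat.of R (R ⧸ I ^ k)) N j →ₗ[R] L} (hL : IsLocalH I j N ι) :
    Nonempty (Ext N M i ≃ₗ[R] (L →ₗ[R] E)) := by
  induction j generalizing i N L with
  | zero =>
    obtain rfl : i = d := hij
    obtain ⟨e⟩ := hL.nonempty_equiv_torsionSub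
    exact ⟨hτ.topEquiv N ≪≫ₗ e.symm.arrowCongr (LinearEquiv.refl R E)⟩
  | succ j ih =>
    -- Passing to the cokernel of `f` raises the degree of `Ext` by one and lowers that of local
    -- cohomology by one.
    obtain ⟨Q, f, hQ, hf⟩ := exists_injective_embedding N
    have hS := cokerSES_shortExact f hf
    have hQi : Subsingleton (Ext Q M i) := hτ.ext_injective_subsingleton Q hQ i (by omega)
    let a : Ext N M i →ₗ[R] Ext (cokerSES f).X₃ M (1 + i) := hS.extClass.precompOfLinear R M rfl
    have ha : Function.Injective a := by
      rw [← LinearMap.ker_eq_bot, LinearMap.ker_eq_bot']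
      intro x hx
      obtain ⟨y, rfl⟩ := Ext.contravariant_sequence_exact₁ hS M x rfl hx
      have h0 : y = 0 := hQi.elim _ _
      rw [h0, Ext.comp_zero]
    -- In degree one neither `Ext^d(Q, M)` nor the torsion of `Q` need vanish. Both sides are
    -- instead embedded in the maps from the torsion of the cokernel to `E`; each image consists of
    -- the maps vanishing on what comes from the torsion of `Q`.
    rcases j with _ | j
    · obtain rfl : 1 + i = d := by omega
      obtain ⟨δ, hδ, hδ'⟩ := hL.exists_connecting hS
        (fun N => ext_subsingleton_of_injective N Q hQ 1 one_pos)
      let u := hτ.topEquiv (cokerSES f).X₃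
      refine nonempty_equiv_of_range_eq (u.toLinearMap ∘ₗ a) (LinearMap.lcomp R E δ)
        (u.injective.comp ha) ?_ ?_
      · intro φ ψ h
        ext x
        obtain ⟨x, rfl⟩ := hδ x
        exact LinearMap.congr_fun h x
      · ext φ
        constructor
        · rintro ⟨x, rfl⟩
          have h1 : u (a x) ∘ₗ torsionMap I (cokerSES f).g.hom = 0 := by
            rw [← hτ.topEquiv_naturality]
            have : (Ext.mk₀ (cokerSES f).g).comp (a x) (zero_add _) = 0 :=
              hS.comp_extClass_assoc x rfl
            exact (congrArg (hτ.topEquiv Q) this).trans (map_zero _)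
          have h2 : LinearMap.ker δ ≤ LinearMap.ker (u (a x)) := by
            intro y hy
            obtain ⟨z, rfl⟩ := (hδ' y).1 hy
            exact LinearMap.congr_fun h1 z
          refine ⟨(LinearMap.ker δ).liftQ (u (a x)) h2 ∘ₗ
            (δ.quotKerEquivOfSurjective hδ).symm.toLinearMap, ?_⟩
          ext y
          have h3 : (δ.quotKerEquivOfSurjective hδ).symm (δ y) = Submodule.Quotient.mk y := by
            rw [LinearEquiv.symm_apply_eq]; rfl
          simp only [LinearMap.lcomp_apply, LinearMap.comp_apply, LinearEquiv.coe_coe, h3]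
          rfl
        · rintro ⟨ψ, rfl⟩
          obtain ⟨x, hx⟩ := u.surjective (ψ ∘ₗ δ)
          have h1 : (Ext.mk₀ (cokerSES f).g).comp x (zero_add _) = 0 := by
            refine (hτ.topEquiv Q).injective ?_
            refine (hτ.topEquiv_naturality (cokerSES f).g.hom x).trans ?_
            rw [map_zero]
            refine (congrArg (fun z => z ∘ₗ torsionMap I (cokerSES f).g.hom) hx).trans ?_
            ext z
            change ψ (δ _) = 0
            rw [(hδ' _).2 ⟨z, rfl⟩, map_zero]
          obtain ⟨y, hy⟩ := Ext.contravariant_sequence_exact₃ hS M x h1 rfl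
          exact ⟨y, (congrArg u hy).trans hx⟩
    · obtain ⟨ι', hL'⟩ := exists_isLocalH I (j + 1) (cokerSES f).X₃
      obtain ⟨e⟩ := hL'.nonempty_equiv_of_shortExact hS (j + 1)
        (fun N => ext_subsingleton_of_injective N Q hQ _ (Nat.succ_pos _))
        (fun N => ext_subsingleton_of_injective N Q hQ _ (Nat.succ_pos _)) hL
      obtain ⟨e'⟩ := ih (1 + i) (by omega) (cokerSES f).X₃ hL'
      have hQi' : Subsingleton (Ext Q M (1 + i)) :=
        hτ.ext_injective_subsingleton Q hQ (1 + i) (by omega)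
      have ha' : Function.Surjective a := fun x =>
        Ext.contravariant_sequence_exact₃ hS M x (hQi'.elim _ _) rfl
      exact ⟨LinearEquiv.ofBijective a ⟨ha, ha'⟩ ≪≫ₗ e' ≪≫ₗ
        e.arrowCongr (LinearEquiv.refl R E)⟩

end Duality

end LocalCM

namespace LocalCM

open Limits Opposite Abelian

variable {R : Type u} [CommRing R]

/-! ### Matlis duality through socles. -/

section Socle

variable [IsLocalRing R] {X : Type u} [AddCommGroup X] [Module R X]

lemma socle_ext {s t : Socle R X} (h : (show ResidueField R →ₗ[R] X from s) 1 =
    (show ResidueField R →ₗ[R] X from t) 1) : s = t :=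
  quotient_hom_ext (J := maximalIdeal R) h

lemma socle_smul_apply (a : ResidueField R) (s : Socle R X) (y : ResidueField R) :
    (show ResidueField R →ₗ[R] X from a • s) y =
      (show ResidueField R →ₗ[R] X from s) (a * y) := rfl

lemma residue_mul (r : R) (y : ResidueField R) : residue R r * y = r • y := by
  rw [Algebra.smul_def]
  rfl

lemma residue_smul_socle (r : R) (s : Socle R X) :
    residue R r • s = (show Socle R X from r • (show ResidueField R →ₗ[R] X from s)) := by
  refine socle_ext ?_
  rw [socle_smul_apply, residue_mul, map_smul]
  rfl

/-- The action of a homomorphism on socles. -/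
noncomputable def socleMap (E : Type u) [AddCommGroup E] [Module R E] :
    (X →ₗ[R] E) →ₛₗ[residue R] (Socle R X →ₗ[ResidueField R] Socle R E) where
  toFun φ :=
    { toFun s := φ ∘ₗ (show ResidueField R →ₗ[R] X from s)
      map_add' s t := LinearMap.comp_add _ _ _
      map_smul' a s := rfl }
  map_add' φ ψ := rfl
  map_smul' r φ := by
    ext s
    change (show Socle R E from r • (φ ∘ₗ (show ResidueField R →ₗ[R] X from s))) =
      residue R r • (show Socle R E from φ ∘ₗ (show ResidueField R →ₗ[R] X from s))
    rw [residue_smul_socle]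

variable {E : Type u} [AddCommGroup E] [Module R E]

lemma socleMap_eq_zero_iff (φ : X →ₗ[R] E) :
    socleMap E φ = 0 ↔ ∀ x, (∀ a ∈ maximalIdeal R, a • x = 0) → φ x = 0 := by
  constructor
  · intro h x hx
    obtain ⟨s, rfl⟩ := exists_residueField_map x hx
    have h1 : socleMap E φ s = 0 := by rw [h]; rfl
    exact LinearMap.congr_fun (show φ ∘ₗ s = 0 from h1) 1
  · intro h
    ext s
    refine socle_ext ?_
    exact h _ fun a ha => smul_residueField_eq_zero _ 1 ha

/-- Evaluation at `1` embeds the socle in `X`, so a map of socles becomes a map into `E` that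
injectivity extends. -/
lemma socleMap_surjective (hE : Module.Injective R E) :
    Function.Surjective (socleMap (R := R) (X := X) E) := by
  intro T
  let ev : (ResidueField R →ₗ[R] X) →ₗ[R] X := LinearMap.applyₗ 1
  have hev : Function.Injective ev := fun s t h => socle_ext h
  let g : (ResidueField R →ₗ[R] X) →ₗ[R] E :=
    { toFun s := (show ResidueField R →ₗ[R] E from T s) 1
      map_add' s t := by
        have : T (show Socle R X from s + t) = T s + T t := map_add T _ _
        exact congrArg (fun f : Socle R E => (show ResidueField R →ₗ[R] E from f) 1) this
      map_smul' r s := by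
        have h1 : T (show Socle R X from r • s) = residue R r • T s := by
          exact (congrArg T (residue_smul_socle r (show Socle R X from s))).symm.trans
            (map_smul T (residue R r) (show Socle R X from s))
        rw [residue_smul_socle] at h1
        exact congrArg (fun f : Socle R E => (show ResidueField R →ₗ[R] E from f) 1) h1 }
  obtain ⟨φ, hφ⟩ := hE.out ev hev g
  exact ⟨φ, LinearMap.ext fun s => socle_ext (hφ s)⟩

/-- For generators `a i` of the maximal ideal, the socle is the kernel of `A = (a i)`. So `φ`
factors through the range of `A` and extends to `Ψ` on `Fin n → X`, whose components express `φ` as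
a combination of the `a i`. -/
lemma mem_smul_top_of_socleMap_eq_zero [IsNoetherianRing R] (hE : Module.Injective R E)
    {φ : X →ₗ[R] E} (hφ : socleMap E φ = 0) :
    φ ∈ (maximalIdeal R • ⊤ : Submodule R (X →ₗ[R] E)) := by
  rw [socleMap_eq_zero_iff] at hφ
  obtain ⟨n, a, ha⟩ := Submodule.fg_iff_exists_fin_generating_family.1
    (IsNoetherian.noetherian (maximalIdeal R))
  let A : X →ₗ[R] (Fin n → X) := LinearMap.pi fun i => LinearMap.lsmul R X (a i)
  have hker : LinearMap.ker A ≤ LinearMap.ker φ := by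
    intro x hx
    refine hφ x fun r hr => ?_
    rw [← ha] at hr
    refine Submodule.span_induction (p := fun r _ => r • x = 0) ?_ (zero_smul R x)
      (fun r s _ _ hr hs => by rw [add_smul, hr, hs, add_zero])
      (fun t r _ hr => by rw [smul_assoc, hr, smul_zero]) hr
    rintro _ ⟨i, rfl⟩
    exact congrFun hx i
  let f₁ : (X ⧸ LinearMap.ker A) →ₗ[R] (Fin n → X) := (LinearMap.ker A).liftQ A le_rfl
  have hf₁ : Function.Injective f₁ := by
    rw [← LinearMap.ker_eq_bot]
    exact Submodule.ker_liftQ_eq_bot _ _ _ le_rfl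
  obtain ⟨Ψ, hΨ⟩ := hE.out f₁ hf₁ ((LinearMap.ker A).liftQ φ hker)
  have hsum : φ = ∑ i, a i • (Ψ ∘ₗ LinearMap.single R (fun _ => X) i) := by
    ext x
    have h1 : Ψ (A x) = φ x := hΨ (Submodule.Quotient.mk x)
    have h2 : A x = ∑ i, Pi.single i (a i • x) :=
      (Finset.univ_sum_single (A x)).symm
    rw [← h1, h2, map_sum, LinearMap.sum_apply]
    refine Finset.sum_congr rfl fun i _ => ?_
    rw [LinearMap.smul_apply, ← map_smul]
    rfl
  rw [hsum]
  refine Submodule.sum_mem _ fun i _ => Submodule.smul_mem_smul ?_ trivial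
  rw [← ha]
  exact Submodule.subset_span ⟨i, rfl⟩

lemma socleMap_eq_zero_of_mem_smul_top {φ : X →ₗ[R] E}
    (hφ : φ ∈ (maximalIdeal R • ⊤ : Submodule R (X →ₗ[R] E))) : socleMap E φ = 0 := by
  refine Submodule.smul_induction_on hφ (fun r hr ψ _ => ?_) fun ψ χ h₁ h₂ => by
    rw [map_add, h₁, h₂, add_zero]
  rw [map_smulₛₗ, (residue_eq_zero_iff r).2 hr, zero_smul]

omit [IsLocalRing R] in
-- A map in `I ^ k • Hom(X, E)` kills every element that `I ^ k` kills.
lemma isHausdorff_hom (I : Ideal R) (hX : IsTorsion I X) : IsHausdorff I (X →ₗ[R] E) := by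
  refine ⟨fun φ hφ => ?_⟩
  ext x
  obtain ⟨k, hk⟩ := hX x
  have h1 := hφ k
  rw [SModEq.zero] at h1
  refine Submodule.smul_induction_on (p := fun φ => φ x = 0) h1 (fun r hr ψ _ => ?_)
    fun ψ χ h₁ h₂ => by rw [LinearMap.add_apply, h₁, h₂, add_zero]
  rw [LinearMap.smul_apply, ← map_smul, hk r hr, map_zero]

/-- A family generating `Hom (X, E)` modulo the maximal ideal generates. -/
lemma surjective_of_socleMap [IsNoetherianRing R] [IsAdicComplete (maximalIdeal R) R]
    (hE : Module.Injective R E) (hX : IsTorsion (maximalIdeal R) X) {P : Type u} [AddCommGroup P]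
    [Module R P] [Module.Finite R P] (F : P →ₗ[R] (X →ₗ[R] E))
    (hF : ∀ T, ∃ r, socleMap E (F r) = T) : Function.Surjective F := by
  have := isHausdorff_hom (E := E) (maximalIdeal R) hX
  have := isPrecomplete_of_finite (maximalIdeal R) P
  -- Nakayama without finiteness of the target: a complete source and a Hausdorff target reduce
  -- surjectivity to the quotient by the maximal ideal.
  refine surjective_of_mkQ_comp_surjective (I := maximalIdeal R) fun y => ?_
  obtain ⟨φ, rfl⟩ := Submodule.Quotient.mk_surjective _ y
  obtain ⟨r, hr⟩ := hF (socleMap E φ)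
  refine ⟨r, (Submodule.Quotient.eq _).2 (mem_smul_top_of_socleMap_eq_zero hE ?_)⟩
  rw [map_sub, hr, sub_self]

lemma IsInjectiveHull.finrank_socle (hE : IsInjectiveHull R (ResidueField R) E) :
    Module.finrank (ResidueField R) (Socle R E) = 1 := by
  obtain ⟨f, hf, hf'⟩ := hE.exists_socle
  refine finrank_eq_one_iff'.2 ⟨f, ?_, fun s => ?_⟩
  · intro h
    exact one_ne_zero (hf ((LinearMap.congr_fun (show f = 0 from h) 1).trans (map_zero f).symm))
  · obtain ⟨y, hy⟩ := hf' ((show ResidueField R →ₗ[R] E from s) 1)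
      fun a ha => smul_residueField_eq_zero _ 1 ha
    refine ⟨y, socle_ext ?_⟩
    exact (congrArg f (mul_one y)).trans hy

/-- The target of `socleMap` is the dual of the socle. -/
lemma IsInjectiveHull.nonempty_socle_dual (hE : IsInjectiveHull R (ResidueField R) E) :
    Nonempty ((Socle R X →ₗ[ResidueField R] Socle R E) ≃ₗ[ResidueField R]
      Module.Dual (ResidueField R) (Socle R X)) := by
  have h := hE.finrank_socle
  have : Module.Finite (ResidueField R) (Socle R E) := Module.finite_of_finrank_eq_succ h
  exact ⟨(LinearEquiv.ofFinrankEq _ _ (h.trans (Module.finrank_self _).symm)).congrRight⟩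

instance : RingHomSurjective (residue R) := ⟨residue_surjective⟩

/-- Matlis duality: finiteness of the dual in terms of the socle. -/
theorem finite_hom_iff [IsNoetherianRing R] [IsAdicComplete (maximalIdeal R) R]
    (hE : IsInjectiveHull R (ResidueField R) E) (hX : IsTorsion (maximalIdeal R) X) :
    Module.Finite R (X →ₗ[R] E) ↔ Module.Finite (ResidueField R) (Socle R X) := by
  obtain ⟨e⟩ := hE.nonempty_socle_dual (X := X)
  constructor
  · intro h
    have h1 : Module.Finite (ResidueField R) (Socle R X →ₗ[ResidueField R] Socle R E) :=
      Module.Finite.of_surjective (socleMap E) (socleMap_surjective hE.injective)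
    have h2 : Module.Finite (ResidueField R) (Module.Dual (ResidueField R) (Socle R X)) :=
      Module.Finite.equiv e
    exact Module.finite_dual_iff (ResidueField R) |>.1 h2
  · intro h
    have h1 : Module.Finite (ResidueField R) (Socle R X →ₗ[ResidueField R] Socle R E) :=
      Module.Finite.equiv e.symm
    obtain ⟨n, v, hv⟩ := Submodule.fg_iff_exists_fin_generating_family.1 h1.fg_top
    choose φ hφ using fun i => socleMap_surjective hE.injective (v i)
    refine Module.Finite.of_surjective (Fintype.linearCombination R φ)
      (surjective_of_socleMap hE.injective hX _ fun T => ?_)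
    have hT : T ∈ Submodule.span (ResidueField R) (Set.range v) := by rw [hv]; trivial
    obtain ⟨a, rfl⟩ := (Submodule.mem_span_range_iff_exists_fun _).1 hT
    choose r hr using fun i => residue_surjective (a i)
    refine ⟨r, ?_⟩
    rw [Fintype.linearCombination_apply, map_sum]
    refine Finset.sum_congr rfl fun i _ => ?_
    rw [map_smulₛₗ, hφ, hr]

/-- If the socle is one-dimensional then the Matlis dual is cyclic. -/
lemma exists_generator_of_finrank_socle_eq_one [IsNoetherianRing R]
    [IsAdicComplete (maximalIdeal R) R] (hE : IsInjectiveHull R (ResidueField R) E)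
    (hX : IsTorsion (maximalIdeal R) X)
    (h : Module.finrank (ResidueField R) (Socle R X) = 1) :
    ∃ φ : X →ₗ[R] E, ∀ ψ : X →ₗ[R] E, ∃ r : R, r • φ = ψ := by
  obtain ⟨e⟩ := hE.nonempty_socle_dual (X := X)
  have h1 : Module.finrank (ResidueField R) (Socle R X →ₗ[ResidueField R] Socle R E) = 1 := by
    rw [e.finrank_eq, Subspace.dual_finrank_eq, h]
  obtain ⟨v, -, hv⟩ := finrank_eq_one_iff'.1 h1
  obtain ⟨φ, rfl⟩ := socleMap_surjective hE.injective v
  refine ⟨φ, surjective_of_socleMap hE.injective hX (LinearMap.toSpanSingleton R _ φ) fun T => ?_⟩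
  obtain ⟨a, rfl⟩ := hv T
  obtain ⟨r, rfl⟩ := residue_surjective a
  exact ⟨r, by rw [LinearMap.toSpanSingleton_apply, map_smulₛₗ]⟩

/-- If the Matlis dual is cyclic and nonzero then the socle is one-dimensional. -/
lemma finrank_socle_eq_one_of_generator [IsNoetherianRing R]
    (hE : IsInjectiveHull R (ResidueField R) E) (hX : Nontrivial (X →ₗ[R] E))
    {φ : X →ₗ[R] E} (hφ : ∀ ψ : X →ₗ[R] E, ∃ r : R, r • φ = ψ) :
    Module.finrank (ResidueField R) (Socle R X) = 1 := by
  obtain ⟨e⟩ := hE.nonempty_socle_dual (X := X)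
  rw [← Subspace.dual_finrank_eq, ← e.finrank_eq]
  refine finrank_eq_one_iff'.2 ⟨socleMap E φ, fun h0 => ?_, fun T => ?_⟩
  · have hfin : Module.Finite R (X →ₗ[R] E) :=
      Module.Finite.of_surjective (LinearMap.toSpanSingleton R _ φ) hφ
    -- If the generator vanished on the socle, so would every map, and Nakayama would make `Hom(X,
    -- E)` zero.
    have htop : (⊤ : Submodule R (X →ₗ[R] E)) ≤ maximalIdeal R • ⊤ := by
      intro ψ _
      refine mem_smul_top_of_socleMap_eq_zero hE.injective ?_
      obtain ⟨r, rfl⟩ := hφ ψ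
      rw [map_smulₛₗ, h0, smul_zero]
    have := Submodule.eq_bot_of_le_smul_of_le_jacobson_bot (maximalIdeal R) ⊤ hfin.fg_top htop
      (maximalIdeal_le_jacobson _)
    exact top_ne_bot this
  · obtain ⟨ψ, rfl⟩ := socleMap_surjective hE.injective T
    obtain ⟨r, rfl⟩ := hφ ψ
    exact ⟨residue R r, by rw [map_smulₛₗ]⟩

end Socle

end LocalCM

namespace LocalCM

open Limits Opposite Abelian

variable {R : Type u} [CommRing R]

/-! ### Dimension and grade. -/

section Dimension

lemma supportDim_le_of_support_subset {M N : Type u} [AddCommGroup M] [Module R M]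
    [AddCommGroup N] [Module R N] (h : Module.support R M ⊆ Module.support R N) :
    Module.supportDim R M ≤ Module.supportDim R N :=
  Order.krullDim_le_of_strictMono (fun a => ⟨a.1, h a.2⟩) fun _ _ lt => lt

lemma support_eq_univ_of_annihilator {M : Type u} [AddCommGroup M] [Module R M]
    [Module.Finite R M] (h : Module.annihilator R M = ⊥) : Module.support R M = Set.univ := by
  rw [Module.support_eq_zeroLocus, h, Submodule.bot_coe, PrimeSpectrum.zeroLocus_singleton_zero]

lemma supportDim_eq_of_annihilator {M : Type u} [AddCommGroup M] [Module R M]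
    [Module.Finite R M] (h : Module.annihilator R M = ⊥) :
    Module.supportDim R M = ringKrullDim R := by
  rw [← Module.supportDim_self_eq_ringKrullDim]
  have h1 := support_eq_univ_of_annihilator h
  have h2 : Module.support R R = Set.univ := support_eq_univ_of_annihilator
    (Module.annihilator_eq_bot.2 inferInstance)
  exact le_antisymm (supportDim_le_of_support_subset (by rw [h2]; exact Set.subset_univ _))
    (supportDim_le_of_support_subset (by rw [h1]; exact Set.subset_univ _))

variable [IsNoetherianRing R] [IsLocalRing R]

/-- For faithful `M`, the support of `M` modulo `rs` is the zero locus of `rs`, which contains that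
of `I`; each regular element lowers the dimension by one. -/
lemma supportDim_quotient_add_length_le {M : Type u} [AddCommGroup M] [Module R M]
    [Module.Finite R M] (h : Module.annihilator R M = ⊥) {I : Ideal R} {rs : List R}
    (hmem : ∀ r ∈ rs, r ∈ I) (hrs : RingTheory.Sequence.IsRegular M rs) :
    Module.supportDim R (R ⧸ I) + rs.length ≤ ringKrullDim R := by
  have h0 : Nontrivial M := hrs.nontrivial
  rw [← supportDim_eq_of_annihilator h,
    ← Module.supportDim_add_length_eq_supportDim_of_isRegular rs hrs]
  refine add_le_add_left (supportDim_le_of_support_subset ?_) _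
  rw [Module.support_quotient, support_eq_univ_of_annihilator h, Set.univ_inter,
    Module.support_eq_zeroLocus, Ideal.annihilator_quotient]
  exact PrimeSpectrum.zeroLocus_anti_mono (Ideal.span_le.2 fun r hr => hmem r hr)

/-- The grade of an ideal on one faithful module bounds the vanishing of `Ext` into any
maximal Cohen-Macaulay module. -/
lemma ext_quotient_subsingleton_of_isRegular {d : ℕ} (hd : ringKrullDim R = d) (N : Type u)
    [AddCommGroup N] [Module R N] [Module.Finite R N]
    (hN : ∀ i < d, Subsingleton (Ext (ModuleCat.of R (ResidueField R)) (ModuleCat.of R N) i))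
    {M : Type u} [AddCommGroup M] [Module R M] [Module.Finite R M]
    (h : Module.annihilator R M = ⊥) {I : Ideal R} (hI : I ≠ ⊤) {rs : List R}
    (hmem : ∀ r ∈ rs, r ∈ I) (hrs : RingTheory.Sequence.IsRegular M rs) (i : ℕ)
    (hi : i < rs.length) : Subsingleton (Ext (ModuleCat.of R (R ⧸ I)) (ModuleCat.of R N) i) := by
  have h1 := supportDim_quotient_add_length_le h hmem hrs
  have : Nontrivial (R ⧸ I) := Ideal.Quotient.nontrivial_iff.2 hI
  have h2 := Module.supportDim_ne_bot_of_nontrivial R (R ⧸ I)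
  have h3 : (0 : WithBot ℕ∞) ≤ Module.supportDim R (R ⧸ I) := by
    obtain ⟨a, ha⟩ := WithBot.ne_bot_iff_exists.1 h2
    rw [← ha]
    exact WithBot.coe_le_coe.2 zero_le
  rw [hd] at h1
  have h4 : rs.length ≤ d := by
    have : ((rs.length : ℕ) : WithBot ℕ∞) ≤ (d : ℕ) :=
      le_trans (by simpa using add_le_add_left h3 (rs.length : WithBot ℕ∞)) h1
    exact_mod_cast this
  -- Ischebeck's theorem applies as `R ⧸ I` has dimension at most `d - rs.length`. Grade thus passes
  -- between modules through dimension.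
  refine ext_subsingleton_of_supportDim N d hN (d - rs.length) (R ⧸ I) inferInstance ?_ i (by omega)
  refine (ENat.WithBot.add_le_add_natCast_right_iff (c := rs.length)).1 (h1.trans ?_)
  exact_mod_cast (by omega : d ≤ d - rs.length + rs.length)

end Dimension

/-! ### Local cohomology through shifts. -/

section LocalCohomology

variable {I : Ideal R}

lemma IsLocalH.isTorsion {i : ℕ} {M : ModuleCat.{u} R} {L : Type u} [AddCommGroup L] [Module R L]
    {ι : ∀ k : ℕ, Ext (ModuleCat.of R (R ⧸ I ^ k)) M i →ₗ[R] L} (hL : IsLocalH I i M ι) :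
    IsTorsion I L := by
  intro x
  obtain ⟨k, e, rfl⟩ := hL.surj x
  refine ⟨k, fun a ha => ?_⟩
  rw [← map_smul, smul_ext_eq_zero_of_left a (fun x => ?_) e, map_zero]
  obtain ⟨r, rfl⟩ := Submodule.Quotient.mk_surjective _ x
  rw [← Submodule.Quotient.mk_smul]
  exact (Submodule.Quotient.mk_eq_zero _).2 (Ideal.mul_mem_right _ _ ha)

/-- Composition with `ε` is an isomorphism of direct systems, each `R ⧸ I ^ k` being torsion. -/
lemma IsShift.nonempty_localH_equiv {c : ℕ} {M : Type u} [AddCommGroup M] [Module R M]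
    {M' : ModuleCat.{u} R} {ε : Ext M' (ModuleCat.of R M) c} (h : IsShift I c ε) :
    Nonempty (localH I c M ≃ₗ[R] torsionSub I M') := by
  obtain ⟨ι, hι⟩ := exists_isLocalH I c M
  obtain ⟨ι₀, h₀, -⟩ := isLocalH_zero I M'
  obtain ⟨e⟩ := h₀.nonempty_equiv hι (fun k => ε.postcompOfLinear R _ (zero_add c))
    (fun k => h _ (isTorsion_quotient_pow I k) 0 c (zero_add c))
    (fun h e => extPowMap_comp ε (zero_add c) h e)
  exact ⟨e.symm⟩

/-- The bottom local cohomology module of `M` represents `Ext^c (-, M)` on torsion modules. -/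
lemma IsShift.nonempty_hom_equiv {c : ℕ} {M : Type u} [AddCommGroup M] [Module R M]
    {M' : ModuleCat.{u} R} {ε : Ext M' (ModuleCat.of R M) c} (h : IsShift I c ε)
    {N : ModuleCat.{u} R} (hN : IsTorsion I N) :
    Nonempty ((N →ₗ[R] localH I c M) ≃ₗ[R] Ext N (ModuleCat.of R M) c) := by
  obtain ⟨e⟩ := h.nonempty_localH_equiv
  exact ⟨(LinearEquiv.refl R N).arrowCongr e ≪≫ₗ homTorsionSubEquiv hN M' ≪≫ₗ
    (extZeroEquiv N M').symm ≪≫ₗ h.equiv N hN 0 c (zero_add c)⟩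

end LocalCohomology

/-! ### The canonical module. -/

section Canonical

/-- If the endomorphism ring is a nonzero cyclic module, every endomorphism is a scalar. -/
lemma algebraMap_end_surjective_of_generator [IsLocalRing R] {H : Type u} [AddCommGroup H]
    [Module R H] {φ : Module.End R H} (hφ : ∀ ψ : Module.End R H, ∃ r : R, r • φ = ψ)
    (hne : (maximalIdeal R • ⊤ : Submodule R (Module.End R H)) ≠ ⊤) :
    Function.Surjective (algebraMap R (Module.End R H)) := by
  obtain ⟨r, hr⟩ := hφ 1
  -- Writing the identity as `r • φ`, every `ψ` equals `r • (ψ * φ)`; so `r` in the maximal ideal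
  -- would contradict `hne`.
  have hu : IsUnit r := by
    by_contra hu
    refine hne (eq_top_iff.2 fun ψ _ => ?_)
    have h1 : ψ = r • (ψ * φ) := by rw [← mul_smul_comm, hr, mul_one]
    rw [h1]
    exact Submodule.smul_mem_smul ((mem_maximalIdeal r).2 hu) trivial
  obtain ⟨t, ht⟩ := hu.exists_left_inv
  intro ψ
  obtain ⟨s, rfl⟩ := hφ ψ
  refine ⟨s * t, ?_⟩
  rw [Algebra.algebraMap_eq_smul_one, ← hr, smul_smul, mul_assoc, ht, mul_one]

variable [IsLocalRing R]

lemma IsCohenMacaulay.idealGrade_eq (h : IsCohenMacaulay R) {d : ℕ} (hd : ringKrullDim R = d) :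
    idealGrade (maximalIdeal R) R = d := by
  have h1 : ((idealGrade (maximalIdeal R) R : ℕ∞) : WithBot ℕ∞) = ((d : ℕ∞) : WithBot ℕ∞) :=
    h.depth_eq.trans hd
  exact WithBot.coe_injective h1

variable {ω : Type u} [AddCommGroup ω] [Module R ω] {d : ℕ}

namespace IsCanonicalModule

variable (hω : IsCanonicalModule R ω) (hd : ringKrullDim R = d)

include hω hd

lemma nontrivial : Nontrivial ω := by
  by_contra hn
  rw [not_nontrivial_iff_subsingleton] at hn
  obtain ⟨e⟩ := hω.type_eq_one d hd
  obtain ⟨x, hx⟩ := e.surjective 1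
  have h1 : (1 : R) • x = 0 := smul_ext_eq_zero_of_right 1 (fun m => hn.elim _ _) x
  rw [one_smul] at h1
  rw [h1, map_zero] at hx
  exact zero_ne_one hx

lemma ext_residueField_subsingleton (i : ℕ) (hi : i < d) :
    Subsingleton (Ext (ModuleCat.of R (ResidueField R)) (ModuleCat.of R ω) i) := by
  have := hω.nontrivial hd
  have h1 : ((idealGrade (maximalIdeal R) ω : ℕ∞) : WithBot ℕ∞) = ((d : ℕ∞) : WithBot ℕ∞) :=
    hω.depth_eq.trans hd
  obtain ⟨rs, hlen, hmem, hrs⟩ := exists_isRegular_of_idealGrade (WithBot.coe_injective h1)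
  refine ext_subsingleton_of_isWeaklyRegular _ rs (fun r hr x => ?_) ω hrs.1 i (by omega)
  exact smul_residueField_eq_zero (LinearMap.id : ResidueField R →ₗ[R] _) x (hmem r hr)

lemma hasInjectiveDimensionLT (hCM : IsCohenMacaulay R) :
    HasInjectiveDimensionLT (ModuleCat.of R ω) (d + 1) := by
  have := hCM.isNoetherianRing
  have := hω.finite
  obtain ⟨rs, f, rfl, -, hrs, hf⟩ := exists_residueField_hom (hCM.idealGrade_eq hd)
  obtain ⟨n, hn⟩ := hω.finite_injectiveDimension
  exact hasInjectiveDimensionLT_of_isRegular ω (n + 1) hn rs hrs f hf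

/-- The canonical module carries a dualizing class. -/
theorem exists_isDualizingClass (hCM : IsCohenMacaulay R) [IsNoetherianRing R] {E : Type u}
    [AddCommGroup E] [Module R E] (hE : IsInjectiveHull R (ResidueField R) E) :
    ∃ τ : Ext (ModuleCat.of R E) (ModuleCat.of R ω) d,
      IsDualizingClass (maximalIdeal R) τ := by
  have := hω.hasInjectiveDimensionLT hd hCM
  exact LocalCM.exists_isDualizingClass hE _ d (hω.ext_residueField_subsingleton hd)
    (hω.type_eq_one d hd)
    (HasInjectiveDimensionLT.subsingleton (ModuleCat.of R ω) (d + 1) (d + 1) le_rfl _)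

/-- The canonical module is faithful. -/
lemma annihilator_eq_bot (hCM : IsCohenMacaulay R) {E : Type u}
    [AddCommGroup E] [Module R E] (hE : IsInjectiveHull R (ResidueField R) E) :
    Module.annihilator R ω = ⊥ := by
  have := hCM.isNoetherianRing
  obtain ⟨τ, hτ⟩ := hω.exists_isDualizingClass hd hCM hE
  refine eq_bot_iff.2 fun a ha => ?_
  rw [Module.mem_annihilator] at ha
  rw [Submodule.mem_bot]
  refine hE.eq_zero_of_smul_eq_zero fun x => ?_
  let e := hτ.equiv (ModuleCat.of R E) hE.isTorsion
  -- Since `a` kills `ω`, it kills `Ext^d(E, ω) ≅ Hom(E, E)`, hence `E`, which is faithful.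
  have h1 : a • (LinearMap.id : E →ₗ[R] E) = 0 := e.injective (by
    rw [map_smul, map_zero]
    exact smul_ext_eq_zero_of_right a ha _)
  exact LinearMap.congr_fun h1 x

lemma ext_quotient_subsingleton (hCM : IsCohenMacaulay R) {I : Ideal R} (hI : I ≠ ⊤) {c : ℕ}
    (hc : idealGrade I R = c) (i : ℕ) (hi : i < c) :
    Subsingleton (Ext (ModuleCat.of R (R ⧸ I)) (ModuleCat.of R ω) i) := by
  have := hCM.isNoetherianRing
  have := hω.finite
  obtain ⟨rs, rfl, hmem, hrs⟩ := exists_isRegular_of_idealGrade hc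
  exact ext_quotient_subsingleton_of_isRegular hd ω (hω.ext_residueField_subsingleton hd)
    (Module.annihilator_eq_bot.2 inferInstance) hI hmem hrs i hi

/-- Otherwise Rees gives an `ω`-regular sequence of length `c + 1` in `I`. As `ω` is faithful this
bounds the dimension of `R ⧸ I`, and Ischebeck and Rees over `R` give an `R`-regular sequence of the
same length. -/
lemma not_ext_quotient_subsingleton (hCM : IsCohenMacaulay R) {E : Type u}
    [AddCommGroup E] [Module R E] (hE : IsInjectiveHull R (ResidueField R) E) {I : Ideal R}
    (hI : I ≠ ⊤) {c : ℕ} (hc : idealGrade I R = c) :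
    ¬ Subsingleton (Ext (ModuleCat.of R (R ⧸ I)) (ModuleCat.of R ω) c) := by
  intro h
  have := hCM.isNoetherianRing
  have := hω.finite
  have := hω.nontrivial hd
  obtain ⟨rs, hlen, hmem, hrs⟩ := exists_isRegular_of_ext I (le_maximalIdeal hI) (c + 1) ω
    fun i hi => by
      rcases Nat.lt_succ_iff_lt_or_eq.1 hi with hi | rfl
      · exact hω.ext_quotient_subsingleton hd hCM hI hc i hi
      · exact h
  have hR : ∀ i < d, Subsingleton
      (Ext (ModuleCat.of R (ResidueField R)) (ModuleCat.of R R) i) := by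
    intro i hi
    obtain ⟨rs, rfl, hmem, hrs⟩ := exists_isRegular_of_idealGrade (hCM.idealGrade_eq hd)
    refine ext_subsingleton_of_isWeaklyRegular _ rs (fun r hr x => ?_) R hrs.1 i hi
    exact smul_residueField_eq_zero (LinearMap.id : ResidueField R →ₗ[R] _) x (hmem r hr)
  obtain ⟨ss, hlen', hmem', hss⟩ := exists_isRegular_of_ext I (le_maximalIdeal hI) (c + 1) R
    fun i hi => ext_quotient_subsingleton_of_isRegular hd R hR
      (hω.annihilator_eq_bot hd hCM hE) hI hmem hrs i (by omega)
  have := length_le_of_idealGrade hc hmem' hss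
  omega

end IsCanonicalModule

end Canonical

end LocalCM

/-! ### The theorem. -/

theorem theorem2p2 {R : Type u} [CommRing R] [IsLocalRing R]
    (hCM : LocalCM.IsCohenMacaulay R) (hcomplete : IsAdicComplete (maximalIdeal R) R)
    (ω : Type u) [AddCommGroup ω] [Module R ω] (hω : LocalCM.IsCanonicalModule R ω)
    (E : Type u) [AddCommGroup E] [Module R E]
    (hE : LocalCM.IsInjectiveHull R (ResidueField R) E)
    (I : Ideal R) (hI : I ≠ ⊤)
    (d c : ℕ) (hd : ringKrullDim R = d) (hc : LocalCM.idealGrade I R = c) :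
    (Nonempty (Module.End R (LocalCM.localH I c ω) ≃ₗ[R]
        Abelian.Ext (LocalCM.localH I c ω) (ModuleCat.of R ω) c) ∧
      Nonempty (Abelian.Ext (LocalCM.localH I c ω) (ModuleCat.of R ω) c ≃ₗ[R]
        (LocalCM.localH (maximalIdeal R) (d - c) (LocalCM.localH I c ω) →ₗ[R] E))) ∧
    (Module.Finite R (Module.End R (LocalCM.localH I c ω)) ↔
      Module.Finite (ResidueField R)
        (LocalCM.Socle R (LocalCM.localH (maximalIdeal R) (d - c) (LocalCM.localH I c ω)))) ∧
    (Function.Surjective (algebraMap R (Module.End R (LocalCM.localH I c ω))) ↔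
      Module.finrank (ResidueField R)
        (LocalCM.Socle R (LocalCM.localH (maximalIdeal R) (d - c) (LocalCM.localH I c ω))) = 1) := by
  have := hCM.isNoetherianRing
  have := hω.finite
  have := hω.hasInjectiveDimensionLT hd hCM
  have : IsAdicComplete (maximalIdeal R) ω :=
    { toIsPrecomplete := LocalCM.isPrecomplete_of_finite _ _ }
  obtain ⟨τ, hτ⟩ := hω.exists_isDualizingClass hd hCM hE
  obtain ⟨M', ε, hε⟩ := LocalCM.exists_shift I c (ModuleCat.of R ω)
    (hω.ext_quotient_subsingleton hd hCM hI hc)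
  have hshift : LocalCM.IsShift I c ε := fun N hN => (hε N hN).2
  have hcd : c ≤ d := by
    obtain ⟨rs, rfl, hmem, hrs⟩ := LocalCM.exists_isRegular_of_idealGrade hc
    exact LocalCM.length_le_of_idealGrade (hCM.idealGrade_eq hd)
      (fun r hr => le_maximalIdeal hI (hmem r hr)) hrs
  obtain ⟨ι₁, hι₁⟩ := LocalCM.exists_isLocalH I c ω
  obtain ⟨ι₂, hι₂⟩ := LocalCM.exists_isLocalH (maximalIdeal R) (d - c) (LocalCM.localH I c ω)
  obtain ⟨e₁⟩ := hshift.nonempty_hom_equiv (N := LocalCM.localH I c ω) hι₁.isTorsion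
  obtain ⟨e₂⟩ := hτ.nonempty_equiv (d - c) c (by omega) (LocalCM.localH I c ω) hι₂
  have e := e₁ ≪≫ₗ e₂
  have hX := hι₂.isTorsion
  refine ⟨⟨⟨e₁⟩, ⟨e₂⟩⟩, ?_, ?_, ?_⟩
  · rw [← LocalCM.finite_hom_iff hE hX]
    exact Module.Finite.equiv_iff e
  · intro hs
    -- If the endomorphism ring were zero, so would be `H^c_I(ω)`, and with it `Hom(R/I, H^c_I(ω)) ≅
    -- Ext^c(R/I, ω)`.
    have hH : Nontrivial (Module.End R (LocalCM.localH I c ω)) := by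
      by_contra hn
      rw [not_nontrivial_iff_subsingleton] at hn
      have hH : Subsingleton (LocalCM.localH I c ω) :=
        ⟨fun x y => by
          have h1 := LinearMap.congr_fun (hn.elim 1 0) x
          have h2 := LinearMap.congr_fun (hn.elim 1 0) y
          exact h1.trans h2.symm⟩
      obtain ⟨e₃⟩ := hshift.nonempty_hom_equiv (N := ModuleCat.of R (R ⧸ I))
        (LocalCM.isTorsion_quotient I)
      refine hω.not_ext_quotient_subsingleton hd hCM hE hI hc ?_
      refine e₃.toEquiv.subsingleton_congr.1 ⟨fun f g => LinearMap.ext fun x => hH.elim _ _⟩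
    refine LocalCM.finrank_socle_eq_one_of_generator hE e.symm.toEquiv.nontrivial (φ := e 1)
      fun ψ => ?_
    obtain ⟨r, hr⟩ := hs (e.symm ψ)
    refine ⟨r, ?_⟩
    rw [← map_smul, ← Algebra.algebraMap_eq_smul_one, hr, LinearEquiv.apply_symm_apply]
  · intro h
    obtain ⟨φ, hφ⟩ := LocalCM.exists_generator_of_finrank_socle_eq_one hE hX h
    refine LocalCM.algebraMap_end_surjective_of_generator (φ := e.symm φ) (fun ψ => ?_) ?_
    · obtain ⟨r, hr⟩ := hφ (e ψ)
      exact ⟨r, by rw [← map_smul, hr, LinearEquiv.symm_apply_apply]⟩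
    -- Were the endomorphism ring equal to its multiple by the maximal ideal, every `socleMap` would
    -- vanish; being surjective onto a copy of the dual of the socle, it would force socle rank
    -- zero.
    · intro htop
      have h0 : ∀ ψ : LocalCM.localH (maximalIdeal R) (d - c) (LocalCM.localH I c ω) →ₗ[R] E,
          LocalCM.socleMap E ψ = 0 := by
        intro ψ
        refine LocalCM.socleMap_eq_zero_of_mem_smul_top ?_
        have h1 : e.symm ψ ∈ (maximalIdeal R • ⊤ : Submodule R (Module.End R _)) := by
          rw [htop]; trivial
        have h2 := Submodule.mem_map_of_mem (f := e.toLinearMap) h1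
        rw [Submodule.map_smul''] at h2
        have h3 : e.toLinearMap (e.symm ψ) = ψ := e.apply_symm_apply ψ
        rw [h3] at h2
        exact Submodule.smul_mono le_rfl le_top h2
      obtain ⟨f⟩ := hE.nonempty_socle_dual (X := LocalCM.localH (maximalIdeal R) (d - c)
        (LocalCM.localH I c ω))
      have h1 : Subsingleton (Module.Dual (ResidueField R) (LocalCM.Socle R
          (LocalCM.localH (maximalIdeal R) (d - c) (LocalCM.localH I c ω)))) := by
        refine f.toEquiv.subsingleton_congr.1 (subsingleton_of_forall_eq 0 fun T => ?_)
        obtain ⟨ψ, rfl⟩ := LocalCM.socleMap_surjective hE.injective T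
        exact h0 ψ
      rw [← Subspace.dual_finrank_eq, Module.finrank_zero_of_subsingleton] at h
      exact zero_ne_one h
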